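/- Let $\alpha\in(0,2)$, $C_\alpha=\left(\frac{(2-\alpha)(4-\alpha)}{\pi}\right)^{\frac1{4-\alpha}}$, and for $\mu>0$, $\zeta\in\mathbb R^2$ put $$U_{\mu,\zeta}(x)=\frac{4-\alpha}{2}\log\frac{C_\alpha\mu}{1+\mu^2|x-\zeta|^2},\qquad U=U_{1,0}.$$ Let $L^2_w(\mathbb R^2)$ be the space of real measurable functions $u$ with $\|u\|_{L^2_w}:=\left\|\frac{u}{1+|x|^2}\right\|_{L^2(\mathbb R^2)}<\infty$, and $H^1_w(\mathbb R^2)$ the space of those $u\in L^2_w(\mathbb R^2)$ whose weak gradient lies in $L^2(\mathbb R^2)$, with norm $\|u\|_{H^1_w}:=\left(\|\nabla u\|_{L^2}^2+\|u\|_{L^2_w}^2\right)^{1/2}$. For $\varphi\in L^2_w(\mathbb R^2)$ write $$\mathfrak N(\varphi)(x)=\left(\int_{\mathbb R^2}\frac{e^{U(y)}\varphi(y)}{|x-y|^\alpha}\,dy\right)e^{U(x)}+\left(\int_{\mathbb R^2}\frac{e^{U(y)}}{|x-y|^\alpha}\,dy\right)e^{U(x)}\varphi(x).$$ Suppose that $\varphi\in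 L^2_w(\mathbb R^2)$ is a distributional solution of $-\Delta\varphi=\mathfrak N(\varphi)$ in $\mathbb R^2$, that is, $-\int_{\mathbb R^2}\varphi\,\Delta\psi\,dx=\int_{\mathbb R^2}\mathfrak N(\varphi)\,\psi\,dx$ for all $\psi\in C_c^\infty(\mathbb R^2)$. Then $\varphi$ and $\mathfrak N(\varphi)$ are locally integrable (so that the notion of solution is meaningful), and, after modification of $\varphi$ on a null set: 1. $\varphi\in L^\infty(\mathbb R^2)\cap C^\infty(\mathbb R^2)$; 2. $\Delta\varphi$ and $e^{\frac4{4-\alpha}U}\varphi$ are integrable and $$-\int_{\mathbb R^2}\Delta\varphi\,dx=\frac{4(4-\alpha)}{C_\alpha^2}\int_{\mathbb R^2}e^{\frac{4}{4-\alpha}U(x)}\varphi(x)\,dx=0;$$ 3. (nondegeneracy of $U$) there are $a_1,a_2,b\in\mathbb R$ such that for all $x\in\mathbb R^2$ $$\varphi(x)=\sum_{j=1}^2a_j\,\partial_{\zeta_j}U_{\mu,\zeta}(x)\big|_{\mu=1,\zeta=0}+b\,\partial_\mu U_{\mu,\zeta}(x)\big|_{\mu=1,\zeta=0}=\sum_{j=1}^2a_j\frac{(4-\alpha)x_j}{1+|x|^2}+b\,\frac{4-\alpha}{2}\,\frac{1-|x|^2}{1+|x|^2};$$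 4. $\varphi\in H^1_w(\mathbb R^2)$ and $\|\varphi\|_{H^1_w}\le\sqrt{4(4-\alpha)+1}\;\|\varphi\|_{L^2_w}$. -/

import Mathlib

open MeasureTheory
open scoped ContDiff Laplacian

noncomputable section

/-- The Euclidean plane. -/
abbrev Plane : Type := EuclideanSpace ℝ (Fin 2)

/-- `j`-th standard basis vector of the plane. -/
def stdVec (j : Fin 2) : Plane := EuclideanSpace.single j 1

/-- The constant `C_α = ((2 - α)(4 - α) / π) ^ (1 / (4 - α))`. -/
def bubbleConst (α : ℝ) : ℝ :=
  ((2 - α) * (4 - α) / Real.pi) ^ (1 / (4 - α))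

/-- The bubbles `U_{μ,ζ}(x) = (4 - α)/2 * log (C_α μ / (1 + μ² |x - ζ|²))`. -/
def bubbleFamily (α μ : ℝ) (ζ x : Plane) : ℝ :=
  (4 - α) / 2 * Real.log (bubbleConst α * μ / (1 + μ ^ 2 * ‖x - ζ‖ ^ 2))

/-- The normalized bubble `U = U_{1,0}`. -/
def bubble (α : ℝ) (x : Plane) : ℝ := bubbleFamily α 1 0 x

/-- The right-hand side of the linearized equation,
`(∫ e^{U(y)} φ(y) / |x-y|^α dy) e^{U(x)} + (∫ e^{U(y)} / |x-y|^α dy) e^{U(x)} φ(x)`. -/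
def linearizedRHS (α : ℝ) (φ : Plane → ℝ) (x : Plane) : ℝ :=
  (∫ y, Real.exp (bubble α y) * φ y / ‖x - y‖ ^ α) * Real.exp (bubble α x) +
    (∫ y, Real.exp (bubble α y) / ‖x - y‖ ^ α) * Real.exp (bubble α x) * φ x

/-- Test functions `C_c^∞(ℝ²)`. -/
def IsTestFunction (ψ : Plane → ℝ) : Prop :=
  ContDiff ℝ ∞ ψ ∧ HasCompactSupport ψ

/-- The identity that makes `u` a distributional solution of `-Δ u = f` in the plane, for `u` and
`f` locally integrable. -/
def IsDistributionalSolution (u f : Plane → ℝ) : Prop :=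
  ∀ ψ : Plane → ℝ, IsTestFunction ψ → -∫ x, u x * (Δ ψ) x = ∫ x, f x * ψ x

/-- Membership in `L²_w(ℝ²)`: `u / (1 + |x|²)` belongs to `L²(ℝ²)`. -/
def MemL2w (u : Plane → ℝ) : Prop :=
  MemLp (fun x => u x / (1 + ‖x‖ ^ 2)) 2 volume

/-- The norm of `L²_w(ℝ²)`. -/
def l2wNorm (u : Plane → ℝ) : ℝ :=
  (eLpNorm (fun x => u x / (1 + ‖x‖ ^ 2)) 2 volume).toReal

/-- `G` is a weak (distributional) gradient of `u`. -/
def HasWeakGradient (u : Plane → ℝ) (G : Plane → Plane) : Prop :=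
  LocallyIntegrable u volume ∧ LocallyIntegrable G volume ∧
    ∀ ψ : Plane → ℝ, IsTestFunction ψ → ∀ j : Fin 2,
      ∫ x, u x * lineDeriv ℝ ψ x (stdVec j) = -∫ x, G x j * ψ x

open Classical in
/-- The weak gradient of `u` (determined almost everywhere), and `0` if there is none. -/
def weakGradient (u : Plane → ℝ) : Plane → Plane :=
  if h : ∃ G, HasWeakGradient u G then h.choose else 0

/-- Membership in `H¹_w(ℝ²)`: `u` is weakly differentiable, `∇u ∈ L²` and `u ∈ L²_w`. -/
def MemH1w (u : Plane → ℝ) : Prop :=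
  HasWeakGradient u (weakGradient u) ∧ MemLp (weakGradient u) 2 volume ∧ MemL2w u

/-- The norm of `H¹_w(ℝ²)`. -/
def h1wNorm (u : Plane → ℝ) : ℝ :=
  √((eLpNorm (weakGradient u) 2 volume).toReal ^ 2 + l2wNorm u ^ 2)

/-- Weak gradients are unique almost everywhere, so `weakGradient` does not depend on a choice. -/
theorem HasWeakGradient.ae_eq {u : Plane → ℝ} {G H : Plane → Plane}
    (hG : HasWeakGradient u G) (hH : HasWeakGradient u H) : G =ᵐ[volume] H := by
  have key : ∀ j : Fin 2, (fun x => G x j) =ᵐ[volume] fun x => H x j := by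
    intro j
    have hloc : ∀ F : Plane → Plane, LocallyIntegrable F volume →
        LocallyIntegrable (fun x => F x j) volume := by
      intro F hF x
      obtain ⟨s, hs, hi⟩ := hF x
      exact ⟨s, hs, (EuclideanSpace.proj j : Plane →L[ℝ] ℝ).integrable_comp hi⟩
    refine ae_eq_of_integral_contDiff_smul_eq (hloc G hG.2.1) (hloc H hH.2.1) ?_
    intro g hg hc
    have h1 := hG.2.2 g ⟨hg, hc⟩ j
    have h2 := hH.2.2 g ⟨hg, hc⟩ j
    have h3 : ∫ x, G x j * g x = ∫ x, H x j * g x := by linarith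
    simpa [smul_eq_mul, mul_comm] using h3
  filter_upwards [key 0, key 1] with x h0 h1
  ext j
  fin_cases j
  · exact h0
  · exact h1

end

/-! Stereographic projection turns the equation into one on the sphere. With `wt` $=(1+|x|^2)^{-1}$,
the functions `sph p q` are the restrictions of linear functions to $S^2$, and $-\Delta
u=8\,\mathrm{wt}^2u$ for each of them. The Riesz potential of $e^U$ times $e^U$ equals
$2(4-\alpha)\,\mathrm{wt}^2$, so the equation reads $-\Delta\varphi=A+\kappa\,\mathrm{wt}^2\varphi$
with $\kappa=2(4-\alpha)$ and $A$ the nonlocal term `rieszTerm`. No spherical harmonic decomposition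
is used: everything is read off from the moments $m_k=\int\varphi\,\mathrm{wt}^2u^k$ and $n_k=\int
A\,u^k$, where $u$ runs over the linear functions given by unit vectors.

Two relations link these moments. First, for $|t|<1$ the function $e^U(1-tu)^{-(4-\alpha)/2}$ is a
multiple of another bubble (`one_sub_mul_sph`), and its potential is explicit by inversion
(`riesz_potential_bubble`). As the kernel is symmetric, this yields the generating identity
`integral_rieszTerm_mul_rpow`. If all moments of order below $k$ vanish, comparing leading
coefficients in $t$ gives $b\,n_k=\kappa b'm_k$, where $b,b'$ are the $k$-th coefficients of
$(1-y)^{-(4-\alpha)/2}$ and $(1-y)^{-\alpha/2}$. Second, testing the weak equation with $u^k$ minus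
its value at infinity (`weak_moment_identity`) gives $n_k=(4k(k+1)-\kappa)m_k$, again when the lower
moments vanish.

Since $b'\le b$ and $4k(k+1)\ge24>2\kappa$ for $k\ge2$, both relations force $m_k=0$. For $k=1$ the
linear functions do solve the equation (`rieszTerm_sph`), so the orthogonal projection of $\varphi$
onto them is subtracted beforehand; the case $k=0$ comes from testing with the vertical coordinate.
An integrable function with vanishing moments along all linear functions is zero
(`ae_eq_zero_of_moments`), by uniqueness of characteristic functions. Hence $\varphi$ is itself some
`sph p q`, and the remaining claims are computations with that function. -/

noncomputable section

/-! ### Linear functions on the sphere in stereographic coordinates -/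

/-- The conformal weight `1 / (1 + |x|²)`. -/
def wt (x : Plane) : ℝ := (1 + ‖x‖ ^ 2)⁻¹

/-- The linear function `ξ ↦ ⟪(p, q), ξ⟫` on the sphere in stereographic coordinates. -/
def sph (p : Plane) (q : ℝ) (x : Plane) : ℝ := (2 * inner ℝ p x + q * (1 - ‖x‖ ^ 2)) * wt x

lemma one_add_normSq_pos (x : Plane) : 0 < 1 + ‖x‖ ^ 2 := by positivity

lemma wt_pos (x : Plane) : 0 < wt x := inv_pos.2 (one_add_normSq_pos x)

lemma wt_le_one (x : Plane) : wt x ≤ 1 := inv_le_one_of_one_le₀ (by nlinarith [sq_nonneg ‖x‖])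

lemma wt_mul (x : Plane) : wt x * (1 + ‖x‖ ^ 2) = 1 := inv_mul_cancel₀ (one_add_normSq_pos x).ne'

lemma contDiff_wt {n : WithTop ℕ∞} : ContDiff ℝ n wt :=
  (contDiff_const.add (contDiff_norm_sq ℝ)).inv fun x => (one_add_normSq_pos x).ne'

lemma contDiff_sph {n : WithTop ℕ∞} (p : Plane) (q : ℝ) : ContDiff ℝ n (sph p q) := by
  unfold sph
  exact ((contDiff_const.mul (contDiff_const.inner ℝ contDiff_id)).add
    (contDiff_const.mul (contDiff_const.sub (contDiff_norm_sq ℝ)))).mul contDiff_wt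

lemma continuous_wt : Continuous wt := (contDiff_wt (n := 0)).continuous

lemma continuous_sph (p : Plane) (q : ℝ) : Continuous (sph p q) :=
  (contDiff_sph (n := 0) p q).continuous

lemma normSq_eq (x : Plane) : ‖x‖ ^ 2 = x 0 ^ 2 + x 1 ^ 2 := by
  simp [EuclideanSpace.norm_sq_eq, Fin.sum_univ_two]

lemma inner_eq (p x : Plane) : inner ℝ p x = p 0 * x 0 + p 1 * x 1 := by
  simp [PiLp.inner_apply, Fin.sum_univ_two]; ring

lemma inner_stdVec (x : Plane) (j : Fin 2) : inner ℝ x (stdVec j) = x j := by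
  simp [stdVec, EuclideanSpace.inner_single_right]

lemma sph_sq_le (p : Plane) (q : ℝ) (x : Plane) : sph p q x ^ 2 ≤ ‖p‖ ^ 2 + q ^ 2 := by
  have h : (2 * inner ℝ p x + q * (1 - ‖x‖ ^ 2)) ^ 2 ≤
      (‖p‖ ^ 2 + q ^ 2) * (1 + ‖x‖ ^ 2) ^ 2 := by
    rw [inner_eq, normSq_eq, normSq_eq]
    -- Cauchy–Schwarz through Lagrange's identity: up to a factor, these are the minors of $(p,q)$
    -- against $(2x,1-|x|^2)$, a vector of length $1+|x|^2$.
    nlinarith [sq_nonneg (p 0 * x 1 - p 1 * x 0),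
      sq_nonneg (q * 2 * x 0 - p 0 * (1 - (x 0 ^ 2 + x 1 ^ 2))),
      sq_nonneg (q * 2 * x 1 - p 1 * (1 - (x 0 ^ 2 + x 1 ^ 2)))]
  calc sph p q x ^ 2 = (2 * inner ℝ p x + q * (1 - ‖x‖ ^ 2)) ^ 2 * wt x ^ 2 := by
        rw [sph, mul_pow]
    _ ≤ (‖p‖ ^ 2 + q ^ 2) * (1 + ‖x‖ ^ 2) ^ 2 * wt x ^ 2 := by gcongr
    _ = (‖p‖ ^ 2 + q ^ 2) * (wt x * (1 + ‖x‖ ^ 2)) ^ 2 := by ring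
    _ = _ := by rw [wt_mul]; ring

lemma abs_sph_le_one {p : Plane} {q : ℝ} (h : ‖p‖ ^ 2 + q ^ 2 = 1) (x : Plane) :
    |sph p q x| ≤ 1 := by
  rw [← sq_le_one_iff_abs_le_one, ← h]; exact sph_sq_le p q x

/-- The value at infinity, i.e. at the south pole, is $-q$, and $4\,\mathrm{wt}$ is the squared
chordal distance to that pole. This is the decay that makes a test function admissible. -/
lemma sph_add_sq_le (p : Plane) (q : ℝ) (x : Plane) :
    (sph p q x + q) ^ 2 ≤ 4 * (‖p‖ ^ 2 + q ^ 2) * wt x := by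
  have h0 : sph p q x + q = (2 * inner ℝ p x + 2 * q) * wt x := by
    have := wt_mul x
    rw [sph]; linear_combination (-q) * this
  have h : (2 * inner ℝ p x + 2 * q) ^ 2 ≤ 4 * (‖p‖ ^ 2 + q ^ 2) * (1 + ‖x‖ ^ 2) := by
    rw [inner_eq, normSq_eq, normSq_eq]
    nlinarith [sq_nonneg (p 0 * x 1 - p 1 * x 0), sq_nonneg (q * x 0 - p 0),
      sq_nonneg (q * x 1 - p 1)]
  calc (sph p q x + q) ^ 2 = (2 * inner ℝ p x + 2 * q) ^ 2 * wt x ^ 2 := by rw [h0, mul_pow]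
    _ ≤ 4 * (‖p‖ ^ 2 + q ^ 2) * (1 + ‖x‖ ^ 2) * wt x ^ 2 := by gcongr
    _ = 4 * (‖p‖ ^ 2 + q ^ 2) * wt x * (wt x * (1 + ‖x‖ ^ 2)) := by ring
    _ = _ := by rw [wt_mul]; ring

/-! ### Partial derivatives, gradients and Laplacians -/

/-- The partial derivative `∂_j f`. -/
def pd (j : Fin 2) (f : Plane → ℝ) (x : Plane) : ℝ := fderiv ℝ f x (stdVec j)

lemma ContDiff.pd {n : WithTop ℕ∞} {m : WithTop ℕ∞} {f : Plane → ℝ} (hf : ContDiff ℝ n f)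
    (hmn : m + 1 ≤ n) (j : Fin 2) : ContDiff ℝ m (pd j f) :=
  (hf.fderiv_right hmn).clm_apply contDiff_const

lemma laplacian_eq_sum_pd {f : Plane → ℝ} (hf : ContDiff ℝ 2 f) (x : Plane) :
    (Δ f) x = ∑ j, pd j (pd j f) x := by
  rw [InnerProductSpace.laplacian_eq_iteratedFDeriv_orthonormalBasis f
    (EuclideanSpace.basisFun (Fin 2) ℝ)]
  refine Finset.sum_congr rfl fun j _ => ?_
  rw [iteratedFDeriv_two_apply]
  have hd : DifferentiableAt ℝ (fderiv ℝ f) x :=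
    ((hf.fderiv_right (m := 1) (by norm_num)).differentiable (by norm_num)) x
  simp only [pd, Matrix.cons_val_zero, Matrix.cons_val_one, EuclideanSpace.basisFun_apply]
  change _ = fderiv ℝ (fun y => fderiv ℝ f y (stdVec j)) x (stdVec j)
  rw [fderiv_clm_apply hd (differentiableAt_const _)]
  simp [stdVec]

lemma pd_mul {f g : Plane → ℝ} (hf : Differentiable ℝ f) (hg : Differentiable ℝ g) (j : Fin 2) :
    pd j (fun x => f x * g x) = fun x => f x * pd j g x + pd j f x * g x := by
  ext x
  simp only [pd, fderiv_fun_mul (hf x) (hg x)]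
  simp [mul_comm]

lemma pd_add {f g : Plane → ℝ} (hf : Differentiable ℝ f) (hg : Differentiable ℝ g) (j : Fin 2) :
    pd j (fun x => f x + g x) = fun x => pd j f x + pd j g x := by
  ext x
  simp only [pd, fderiv_fun_add (hf x) (hg x)]
  simp

lemma pd_const_mul {f : Plane → ℝ} (c : ℝ) (hf : Differentiable ℝ f) (j : Fin 2) :
    pd j (fun x => c * f x) = fun x => c * pd j f x := by
  ext x
  simp only [pd, fderiv_const_mul (hf x) c]
  simp

lemma pd_sub_const {f : Plane → ℝ} (c : ℝ) (j : Fin 2) :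
    pd j (fun x => f x - c) = pd j f := by
  ext x
  simp [pd, fderiv_sub_const]

lemma pd_pow {f : Plane → ℝ} (hf : Differentiable ℝ f) (k : ℕ) (j : Fin 2) :
    pd j (fun x => f x ^ k) = fun x => k * f x ^ (k - 1) * pd j f x := by
  ext x
  simp only [pd, fderiv_fun_pow k (hf x)]
  simp

lemma pd_wt (j : Fin 2) : pd j wt = fun x => -2 * x j * wt x ^ 2 := by
  ext x
  have h' : HasFDerivAt wt _ x := (hasDerivAt_inv (one_add_normSq_pos x).ne').comp_hasFDerivAt x
    ((hasStrictFDerivAt_norm_sq x).hasFDerivAt.const_add 1)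
  rw [pd, h'.fderiv]
  simp [inner_stdVec, wt]
  ring

lemma pd_coord (i j : Fin 2) : pd j (fun x : Plane => x i) = fun _ => if i = j then 1 else 0 := by
  ext x
  have : HasFDerivAt (fun x : Plane => x i) (EuclideanSpace.proj i : Plane →L[ℝ] ℝ) x :=
    (EuclideanSpace.proj i : Plane →L[ℝ] ℝ).hasFDerivAt
  rw [pd, this.fderiv]
  simp [stdVec]

lemma sph_eq (p : Plane) (q : ℝ) (x : Plane) :
    sph p q x = (2 * inner ℝ p x + 2 * q) * wt x - q := by
  have := wt_mul x
  rw [sph]; linear_combination (-q) * this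

lemma pd_inner (p : Plane) (q : ℝ) (j : Fin 2) :
    pd j (fun x => 2 * inner ℝ p x + 2 * q) = fun _ => 2 * p j := by
  ext x
  have h : HasFDerivAt (fun x => 2 * inner ℝ p x + 2 * q) ((2 : ℝ) • innerSL ℝ p) x :=
    (((innerSL ℝ p).hasFDerivAt (x := x)).const_mul 2).add_const (2 * q)
  rw [pd, h.fderiv]
  simp [inner_stdVec]

lemma differentiable_wt : Differentiable ℝ wt := contDiff_wt.differentiable (n := 1) (by norm_num)

lemma differentiable_sph (p : Plane) (q : ℝ) : Differentiable ℝ (sph p q) :=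
  (contDiff_sph p q).differentiable (n := 1) (by norm_num)

lemma differentiable_inner_add (p : Plane) (q : ℝ) :
    Differentiable ℝ (fun x : Plane => 2 * inner ℝ p x + 2 * q) :=
  (contDiff_const.mul (contDiff_const.inner ℝ contDiff_id) |>.add contDiff_const).differentiable
    (n := 1) (by norm_num)

lemma pd_sph (p : Plane) (q : ℝ) (j : Fin 2) :
    pd j (sph p q) = fun x => 2 * p j * wt x - 2 * x j * wt x * (sph p q x + q) := by
  have : sph p q = fun x => (2 * inner ℝ p x + 2 * q) * wt x - q := funext (sph_eq p q)
  rw [this, pd_sub_const, pd_mul (differentiable_inner_add p q) differentiable_wt, pd_inner, pd_wt]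
  ext x; ring

/-- The round metric is $4\,\mathrm{wt}^2|dx|^2$, and the spherical gradient of $\xi\mapsto
v\cdot\xi$ has squared length $|v|^2-(v\cdot\xi)^2$. -/
lemma sum_pd_sph_sq (p : Plane) (q : ℝ) (x : Plane) :
    ∑ j, pd j (sph p q) x ^ 2 = 4 * wt x ^ 2 * (‖p‖ ^ 2 + q ^ 2 - sph p q x ^ 2) := by
  have h := wt_mul x
  simp only [pd_sph, Fin.sum_univ_two, sph_eq]
  rw [normSq_eq] at h
  rw [normSq_eq, inner_eq]
  have h2 : wt x * (x 0 ^ 2 + x 1 ^ 2) = 1 - wt x := by linarith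
  linear_combination (16 * (p 0 * x 0 + p 1 * x 1 + q) ^ 2 * wt x ^ 3 ) * h2

/-- In dimension two the Laplacian is conformally covariant, and linear functions on $S^2$ have
eigenvalue $2$; the factor $4\,\mathrm{wt}^2$ makes this $8$. -/
lemma laplacian_sph (p : Plane) (q : ℝ) (x : Plane) :
    (Δ (sph p q)) x = -8 * wt x ^ 2 * sph p q x := by
  rw [laplacian_eq_sum_pd (contDiff_sph p q)]
  have key : ∀ j : Fin 2, pd j (pd j (sph p q)) x =
      -8 * p j * x j * wt x ^ 2 - 2 * wt x * (sph p q x + q)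
        + 8 * x j ^ 2 * wt x ^ 2 * (sph p q x + q) := by
    intro j
    have e : pd j (sph p q) = fun x => (2 * p j) * wt x + (-2) *
        (x j * (wt x * (sph p q x - (-q)))) := by
      rw [pd_sph]; ext x; ring
    have d1 : Differentiable ℝ (fun x : Plane => x j) :=
      (EuclideanSpace.proj j : Plane →L[ℝ] ℝ).differentiable
    have d2 : Differentiable ℝ (fun x => sph p q x - (-q)) := (differentiable_sph p q).sub_const _
    have d3 : Differentiable ℝ (fun x => wt x * (sph p q x - (-q))) := differentiable_wt.mul d2
    rw [e, pd_add (differentiable_wt.const_mul _) ((d1.fun_mul d3).const_mul _),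
      pd_const_mul _ differentiable_wt, pd_const_mul _ (d1.fun_mul d3), pd_mul d1 d3,
      pd_mul differentiable_wt d2, pd_sub_const, pd_coord, pd_wt, pd_sph]
    simp only [if_true]
    ring
  rw [Fin.sum_univ_two, key, key]
  have h := wt_mul x
  rw [normSq_eq] at h
  have h2 : wt x * (x 0 ^ 2 + x 1 ^ 2) = 1 - wt x := by linarith
  rw [sph_eq, inner_eq]
  linear_combination (16 * (p 0 * x 0 + p 1 * x 1 + q) * wt x ^ 2) * h2

lemma laplacian_mul {f g : Plane → ℝ} (hf : ContDiff ℝ 2 f) (hg : ContDiff ℝ 2 g) (x : Plane) :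
    (Δ (fun x => f x * g x)) x =
      f x * (Δ g) x + 2 * (∑ j, pd j f x * pd j g x) + (Δ f) x * g x := by
  rw [laplacian_eq_sum_pd (hf.mul hg), laplacian_eq_sum_pd hf, laplacian_eq_sum_pd hg]
  have df := hf.differentiable (by norm_num)
  have dg := hg.differentiable (by norm_num)
  have df' := fun j => (hf.pd (m := 1) (by norm_num) j).differentiable (by norm_num)
  have dg' := fun j => (hg.pd (m := 1) (by norm_num) j).differentiable (by norm_num)
  have key : ∀ j : Fin 2, pd j (pd j (fun x => f x * g x)) x =
      f x * pd j (pd j g) x + 2 * (pd j f x * pd j g x) + pd j (pd j f) x * g x := by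
    intro j
    rw [pd_mul df dg, pd_add (df.fun_mul (dg' j)) ((df' j).fun_mul dg), pd_mul df (dg' j),
      pd_mul (df' j) dg]
    ring
  simp only [key, Fin.sum_univ_two]
  ring

lemma laplacian_pow {f : Plane → ℝ} (hf : ContDiff ℝ 2 f) (k : ℕ) (x : Plane) :
    (Δ (fun x => f x ^ k)) x =
      k * f x ^ (k - 1) * (Δ f) x + k * (k - 1) * f x ^ (k - 2) * ∑ j, pd j f x ^ 2 := by
  rw [laplacian_eq_sum_pd (hf.pow k), laplacian_eq_sum_pd hf]
  have df := hf.differentiable (by norm_num)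
  have df' := fun j => (hf.pd (m := 1) (by norm_num) j).differentiable (by norm_num)
  have key : ∀ j : Fin 2, pd j (pd j (fun x => f x ^ k)) x =
      k * f x ^ (k - 1) * pd j (pd j f) x + k * (k - 1) * f x ^ (k - 2) * pd j f x ^ 2 := by
    intro j
    rw [pd_pow df, pd_mul ((df.fun_pow _).const_mul _) (df' j), pd_const_mul _ (df.fun_pow _),
      pd_pow df]
    rcases k with _ | _ | k
    · simp
    · simp
    · simp only [Nat.add_sub_cancel]
      push_cast
      ring
  simp only [key, Fin.sum_univ_two]
  ring

lemma laplacian_sph_pow {p : Plane} {q : ℝ} (h : ‖p‖ ^ 2 + q ^ 2 = 1) (k : ℕ) (x : Plane) :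
    (Δ (fun x => sph p q x ^ k)) x = wt x ^ 2 *
      (-4 * k * (k + 1) * sph p q x ^ k + 4 * k * (k - 1) * sph p q x ^ (k - 2)) := by
  rw [laplacian_pow (contDiff_sph p q), laplacian_sph, sum_pd_sph_sq, h]
  rcases k with _ | _ | k
  · simp
  · simp; ring
  · simp only [show k + 1 + 1 - 1 = k + 1 from rfl]
    push_cast
    ring

/-! ### Integrals of powers of the conformal weight -/

lemma wt_eq_rpow (x : Plane) (p : ℝ) : wt x ^ p = (1 + ‖x‖ ^ 2) ^ (-p) := by
  rw [wt, Real.inv_rpow (one_add_normSq_pos x).le, Real.rpow_neg (one_add_normSq_pos x).le]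

lemma hasDerivAt_radial_primitive {p : ℝ} (hp : 1 < p) (r : ℝ) :
    HasDerivAt (fun r : ℝ => -(1 / (2 * (p - 1))) * (1 + r ^ 2) ^ (1 - p))
      (r * (1 + r ^ 2) ^ (-p)) r := by
  have h0 : 0 < 1 + r ^ 2 := by positivity
  have h1 : HasDerivAt (fun r : ℝ => 1 + r ^ 2) (2 * r) r := by
    simpa using (hasDerivAt_pow 2 r).const_add 1
  have h2 := (h1.rpow_const (p := 1 - p) (Or.inl h0.ne')).const_mul (-(1 / (2 * (p - 1))))
  have h3 : p - 1 ≠ 0 := by linarith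
  have h4 : -(1 / (2 * (p - 1))) * (2 * r * (1 - p) * (1 + r ^ 2) ^ (1 - p - 1)) =
      r * (1 + r ^ 2) ^ (-p) := by
    rw [show 1 - p - 1 = -p by ring]
    field_simp
    ring
  rwa [h4] at h2

lemma tendsto_radial_primitive {p : ℝ} (hp : 1 < p) :
    Filter.Tendsto (fun r : ℝ => -(1 / (2 * (p - 1))) * (1 + r ^ 2) ^ (1 - p)) Filter.atTop
      (nhds 0) := by
  have h1 : Filter.Tendsto (fun r : ℝ => 1 + r ^ 2) Filter.atTop Filter.atTop :=
    Filter.tendsto_atTop_add_const_left _ _ (Filter.tendsto_pow_atTop (by norm_num))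
  have h2 := (tendsto_rpow_neg_atTop (y := p - 1) (by linarith)).comp h1
  have h3 := h2.const_mul (-(1 / (2 * (p - 1))))
  simpa [Function.comp_def] using h3

lemma finrank_plane : Module.finrank ℝ Plane = 2 := by simp

lemma integrable_wt_rpow {p : ℝ} (hp : 1 < p) : Integrable fun x : Plane => wt x ^ p := by
  simp only [wt_eq_rpow]
  have h := (integrable_fun_norm_addHaar (volume : Measure Plane)
    (f := fun r : ℝ => (1 + r ^ 2) ^ (-p))).2
  refine h ?_
  rw [finrank_plane]
  simp only [Nat.add_one_sub_one, pow_one, smul_eq_mul]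
  exact integrableOn_Ioi_deriv_of_nonneg' (fun x _ => hasDerivAt_radial_primitive hp x)
    (fun x hx => mul_nonneg (le_of_lt hx) (by positivity)) (tendsto_radial_primitive hp)

lemma integral_wt_rpow {p : ℝ} (hp : 1 < p) : ∫ x : Plane, wt x ^ p = Real.pi / (p - 1) := by
  simp only [wt_eq_rpow]
  have h := integral_fun_norm_addHaar (volume : Measure Plane)
    (fun r : ℝ => (1 + r ^ 2) ^ (-p))
  rw [h, finrank_plane]
  simp only [Nat.add_one_sub_one, pow_one, smul_eq_mul]
  rw [integral_Ioi_of_hasDerivAt_of_nonneg' (fun x _ => hasDerivAt_radial_primitive hp x)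
    (fun x hx => mul_nonneg (le_of_lt hx) (by positivity)) (tendsto_radial_primitive hp)]
  have hb : (volume : Measure Plane).real (Metric.ball 0 1) = Real.pi := by
    simp [Measure.real, Real.pi_pos.le]
  have : p - 1 ≠ 0 := by linarith
  rw [hb]
  simp
  field_simp

/-! ### Inversion and the Riesz potential of a bubble -/

lemma abs_det_fderiv_inversion (x z : Plane) :
    |((1 / dist z x) ^ 2 • ((ℝ ∙ (z - x))ᗮ.reflection : Plane →L[ℝ] Plane)).det|
      = (‖z - x‖ ^ 4)⁻¹ := by
  have h1 : |((ℝ ∙ (z - x))ᗮ.reflection : Plane →L[ℝ] Plane).det| = 1 := by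
    have h := (ℝ ∙ (z - x))ᗮ.det_reflection
    rw [show ((ℝ ∙ (z - x))ᗮ.reflection : Plane →L[ℝ] Plane).det =
      LinearMap.det (ℝ ∙ (z - x))ᗮ.reflection.toLinearMap from rfl, h]
    simp [abs_pow]
  have h2 : ((1 / dist z x) ^ 2 • ((ℝ ∙ (z - x))ᗮ.reflection : Plane →L[ℝ] Plane)).det =
      ((1 / dist z x) ^ 2) ^ 2 * ((ℝ ∙ (z - x))ᗮ.reflection : Plane →L[ℝ] Plane).det := by
    have h := LinearMap.det_smul ((1 / dist z x) ^ 2)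
      ((ℝ ∙ (z - x))ᗮ.reflection : Plane →L[ℝ] Plane).toLinearMap
    rw [finrank_plane] at h
    exact h
  rw [h2, abs_mul, h1, mul_one, abs_of_nonneg (by positivity), dist_eq_norm, one_div,
    ← pow_mul, inv_pow]

open EuclideanGeometry in
/-- Change of variables under inversion in a unit circle. -/
lemma integral_comp_inversion (x : Plane) (g : Plane → ℝ) :
    (Integrable g ↔ Integrable fun z => (‖z - x‖ ^ 4)⁻¹ * g (inversion x 1 z)) ∧
      ∫ y, g y = ∫ z, (‖z - x‖ ^ 4)⁻¹ * g (inversion x 1 z) := by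
  have hs : MeasurableSet ({x}ᶜ : Set Plane) := (measurableSet_singleton x).compl
  have him : inversion x 1 '' ({x}ᶜ : Set Plane) = {x}ᶜ := by
    rw [Set.image_compl_eq (inversion_bijective x one_ne_zero)]
    simp
  have hd : ∀ z ∈ ({x}ᶜ : Set Plane), HasFDerivWithinAt (inversion x 1)
      ((1 / dist z x) ^ 2 • ((ℝ ∙ (z - x))ᗮ.reflection : Plane →L[ℝ] Plane)) {x}ᶜ z :=
    fun z hz => (hasFDerivAt_inversion hz).hasFDerivWithinAt
  have hi : Set.InjOn (inversion x (1 : ℝ)) ({x}ᶜ : Set Plane) :=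
    (inversion_injective x one_ne_zero).injOn
  have h1 := integrableOn_image_iff_integrableOn_abs_det_fderiv_smul volume hs hd hi g
  have h2 := integral_image_eq_integral_abs_det_fderiv_smul volume hs hd hi g
  simp only [abs_det_fderiv_inversion, him, IntegrableOn, restrict_compl_singleton,
    smul_eq_mul] at h1 h2
  exact ⟨h1, h2⟩

lemma normSq_inversion (x ζ : Plane) {z : Plane} (hz : z ≠ x) (ρ : ℝ) :
    ρ ^ 2 + ‖EuclideanGeometry.inversion x 1 z - ζ‖ ^ 2 =
      ((ρ ^ 2 + ‖x - ζ‖ ^ 2) * ‖z - x‖ ^ 2 + 2 * inner ℝ (x - ζ) (z - x) + 1) / ‖z - x‖ ^ 2 := by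
  have h0 : ‖z - x‖ ≠ 0 := norm_ne_zero_iff.2 (sub_ne_zero.2 hz)
  have h1 : EuclideanGeometry.inversion x 1 z - ζ = (x - ζ) + (1 / ‖z - x‖) ^ 2 • (z - x) := by
    simp only [EuclideanGeometry.inversion, dist_eq_norm, vsub_eq_sub, vadd_eq_add]
    abel
  rw [h1, norm_add_sq_real, inner_smul_right, norm_smul]
  rw [Real.norm_of_nonneg (by positivity)]
  field_simp
  ring

lemma complete_square (d v : Plane) {ρ : ℝ} (hρ : 0 < ρ) :
    (ρ ^ 2 + ‖d‖ ^ 2) * ‖v‖ ^ 2 + 2 * inner ℝ d v + 1 =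
      ρ ^ 2 / (ρ ^ 2 + ‖d‖ ^ 2) *
        (1 + ‖((ρ ^ 2 + ‖d‖ ^ 2) / ρ) • (v + (ρ ^ 2 + ‖d‖ ^ 2)⁻¹ • d)‖ ^ 2) := by
  have hA : 0 < ρ ^ 2 + ‖d‖ ^ 2 := by positivity
  rw [norm_smul, mul_pow, norm_add_sq_real, inner_smul_right, norm_smul,
    Real.norm_of_nonneg (by positivity), Real.norm_of_nonneg (by positivity), real_inner_comm]
  field_simp
  ring

/-- Inversion at the evaluation point $x$ removes the singular kernel: the powers of $|z-x|$ coming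
from the Jacobian, the kernel and the bubble are $-4$, $\alpha$ and $4-\alpha$, and they cancel. A
power of a quadratic polynomial in $z$ remains. -/
lemma convolution_integrand_inversion {α : ℝ} (x ζ : Plane) {z : Plane} (hz : z ≠ x) {ρ : ℝ}
    (hρ : 0 < ρ) :
    (‖z - x‖ ^ 4)⁻¹ * ((ρ ^ 2 + ‖EuclideanGeometry.inversion x 1 z - ζ‖ ^ 2) ^ (-((4 - α) / 2)) /
        ‖x - EuclideanGeometry.inversion x 1 z‖ ^ α) =
      (ρ ^ 2 / (ρ ^ 2 + ‖x - ζ‖ ^ 2)) ^ (-((4 - α) / 2)) *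
        wt (((ρ ^ 2 + ‖x - ζ‖ ^ 2) / ρ) • (z + ((ρ ^ 2 + ‖x - ζ‖ ^ 2)⁻¹ • (x - ζ) - x))) ^
          ((4 - α) / 2) := by
  have h0 : 0 < ‖z - x‖ := norm_pos_iff.2 (sub_ne_zero.2 hz)
  have hA : 0 < ρ ^ 2 + ‖x - ζ‖ ^ 2 := by positivity
  have hn : ‖x - EuclideanGeometry.inversion x 1 z‖ = ‖z - x‖⁻¹ := by
    rw [← dist_eq_norm, EuclideanGeometry.dist_center_inversion, dist_comm, dist_eq_norm]
    simp
  rw [normSq_inversion x ζ hz, complete_square _ _ hρ, hn, wt_eq_rpow,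
    show z + ((ρ ^ 2 + ‖x - ζ‖ ^ 2)⁻¹ • (x - ζ) - x) =
      z - x + (ρ ^ 2 + ‖x - ζ‖ ^ 2)⁻¹ • (x - ζ) by abel]
  rw [Real.div_rpow (by positivity) (by positivity), Real.mul_rpow (by positivity) (by positivity)]
  rw [Real.inv_rpow h0.le, ← Real.rpow_natCast ‖z - x‖ 4, ← Real.rpow_natCast ‖z - x‖ 2,
    ← Real.rpow_mul h0.le, div_inv_eq_mul, div_mul_eq_mul_div, ← Real.rpow_neg h0.le]
  rw [mul_div_assoc, ← Real.rpow_sub h0, mul_left_comm, ← Real.rpow_add h0]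
  rw [show -((4 : ℕ) : ℝ) + (α - ((2 : ℕ) : ℝ) * -((4 - α) / 2)) = 0 by push_cast; ring,
    Real.rpow_zero, mul_one]

/-- The Riesz potential of a bubble is a power of a bubble. -/
theorem riesz_potential_bubble {α : ℝ} (hα : α < 2) (x ζ : Plane) {ρ : ℝ} (hρ : 0 < ρ) :
    Integrable (fun y => (ρ ^ 2 + ‖y - ζ‖ ^ 2) ^ (-((4 - α) / 2)) / ‖x - y‖ ^ α) ∧
      ∫ y, (ρ ^ 2 + ‖y - ζ‖ ^ 2) ^ (-((4 - α) / 2)) / ‖x - y‖ ^ α =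
        2 * Real.pi / (2 - α) * ρ ^ (α - 2) * (ρ ^ 2 + ‖x - ζ‖ ^ 2) ^ (-(α / 2)) := by
  set A := ρ ^ 2 + ‖x - ζ‖ ^ 2 with hA
  have hA0 : 0 < A := by positivity
  set b := A⁻¹ • (x - ζ) - x
  have hs : 1 < (4 - α) / 2 := by linarith
  obtain ⟨h1, h2⟩ := integral_comp_inversion x
    (fun y => (ρ ^ 2 + ‖y - ζ‖ ^ 2) ^ (-((4 - α) / 2)) / ‖x - y‖ ^ α)
  have hae : (fun z => (‖z - x‖ ^ 4)⁻¹ *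
      ((ρ ^ 2 + ‖EuclideanGeometry.inversion x 1 z - ζ‖ ^ 2) ^ (-((4 - α) / 2)) /
        ‖x - EuclideanGeometry.inversion x 1 z‖ ^ α)) =ᵐ[volume]
      fun z => (ρ ^ 2 / A) ^ (-((4 - α) / 2)) * wt ((A / ρ) • (z + b)) ^ ((4 - α) / 2) := by
    have : ∀ᵐ z : Plane, z ≠ x := by simp [ae_iff]
    filter_upwards [this] with z hz
    exact convolution_integrand_inversion x ζ hz hρ
  have hR : A / ρ ≠ 0 := by positivity
  constructor
  · rw [h1, integrable_congr hae]
    refine Integrable.const_mul ?_ _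
    exact ((integrable_comp_smul_iff volume (fun x => wt x ^ ((4 - α) / 2)) hR).2
      (integrable_wt_rpow hs)).comp_add_right b
  · rw [h2, integral_congr_ae hae, integral_const_mul,
      integral_add_right_eq_self (fun z => wt ((A / ρ) • z) ^ ((4 - α) / 2)) b,
      Measure.integral_comp_smul volume (fun x => wt x ^ ((4 - α) / 2)), integral_wt_rpow hs,
      finrank_plane, abs_of_nonneg (by positivity), smul_eq_mul]
    have e1 : (ρ ^ 2 / A) ^ (-((4 - α) / 2)) = ρ ^ (α - 4) * A ^ ((4 - α) / 2) := by
      rw [Real.div_rpow (by positivity) hA0.le, ← Real.rpow_natCast ρ 2, ← Real.rpow_mul hρ.le,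
        Real.rpow_neg hA0.le, div_inv_eq_mul]
      congr 2
      push_cast; ring
    have e2 : ((A / ρ) ^ 2)⁻¹ = ρ ^ (2 : ℝ) * A ^ (-2 : ℝ) := by
      rw [Real.rpow_neg hA0.le, Real.rpow_two, Real.rpow_two]
      field_simp
    rw [e1, e2, show (α - 2 : ℝ) = (α - 4) + 2 by ring, Real.rpow_add hρ,
      show -(α / 2) = (4 - α) / 2 + -2 by ring, Real.rpow_add hA0]
    have : 2 - α ≠ 0 := by linarith
    rw [show (4 - α) / 2 - 1 = (2 - α) / 2 by ring]
    field_simp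

/-! ### Comparing coefficients of power series -/

open Filter Topology in
lemma tendsto_powerSeries_remainder {a : ℕ → ℝ} {F : ℝ → ℝ}
    (h : ∀ t, |t| < 1 → HasSum (fun k => a k * t ^ k) (F t)) (k : ℕ) :
    Tendsto (fun t => (F t - ∑ j ∈ Finset.range k, a j * t ^ j) / t ^ k) (𝓝[≠] 0) (𝓝 (a k)) := by
  -- A majorant of the shifted series on $|t|\le 1/2$, so that its sum is continuous at $0$, where
  -- it equals $a_k$.
  have hs : Summable fun j => |a (j + k)| * (1 / 2) ^ j := by
    have h1 := (h (1 / 2) (by rw [abs_of_pos] <;> norm_num)).summable.abs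
    have h2 := ((summable_nat_add_iff k).2 h1).mul_right ((2 : ℝ) ^ k)
    refine h2.congr fun j => ?_
    rw [abs_mul, abs_of_pos (by positivity : (0 : ℝ) < (1 / 2) ^ (j + k)), pow_add, mul_assoc,
      mul_assoc, ← mul_pow]
    norm_num
  have hc : ContinuousOn (fun t : ℝ => ∑' j, a (j + k) * t ^ j) (Metric.closedBall 0 (1 / 2)) := by
    refine continuousOn_tsum (fun j => by fun_prop) hs fun j t ht => ?_
    rw [norm_mul, norm_pow, Real.norm_eq_abs]
    have : ‖t‖ ≤ 1 / 2 := by simpa using ht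
    gcongr
  have h0 : Tendsto (fun t : ℝ => ∑' j, a (j + k) * t ^ j) (𝓝[≠] 0) (𝓝 (a k)) := by
    have h1 := (hc.continuousAt (Metric.closedBall_mem_nhds 0 (by norm_num))).tendsto
    have h2 : ∑' j, a (j + k) * (0 : ℝ) ^ j = a k := by
      rw [tsum_eq_single 0 (fun j hj => by simp [hj])]
      simp
    rw [h2] at h1
    exact h1.mono_left nhdsWithin_le_nhds
  refine h0.congr' ?_
  have hball : Metric.ball (0 : ℝ) 1 ∈ 𝓝[≠] (0 : ℝ) :=
    mem_nhdsWithin_of_mem_nhds (Metric.ball_mem_nhds 0 (by norm_num))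
  filter_upwards [hball, self_mem_nhdsWithin] with t ht ht0
  have ht0' : t ≠ 0 := ht0
  have h1 := (hasSum_nat_add_iff' k).2 (h t (by simpa using ht))
  rw [← (h1.div_const (t ^ k)).tsum_eq]
  refine tsum_congr fun j => ?_
  rw [pow_add]
  field_simp

open Filter Topology in
/-- If two power series agree up to a factor `κ g` with `g 0 = 1`, so do their first nonzero
coefficients. -/
lemma leading_coeff_eq {a c : ℕ → ℝ} {F H g : ℝ → ℝ} {κ : ℝ}
    (hF : ∀ t, |t| < 1 → HasSum (fun k => a k * t ^ k) (F t))
    (hH : ∀ t, |t| < 1 → HasSum (fun k => c k * t ^ k) (H t))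
    (hFH : ∀ t, |t| < 1 → F t = κ * g t * H t) (hg0 : g 0 = 1) (hg : ContinuousAt g 0) {k : ℕ}
    (ha : ∀ j < k, a j = 0) (hc : ∀ j < k, c j = 0) : a k = κ * c k := by
  have h1 := tendsto_powerSeries_remainder hF k
  have h2 := tendsto_powerSeries_remainder hH k
  have z1 : ∀ t : ℝ, ∑ j ∈ Finset.range k, a j * t ^ j = 0 := fun t =>
    Finset.sum_eq_zero fun j hj => by rw [ha j (Finset.mem_range.1 hj), zero_mul]
  have z2 : ∀ t : ℝ, ∑ j ∈ Finset.range k, c j * t ^ j = 0 := fun t =>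
    Finset.sum_eq_zero fun j hj => by rw [hc j (Finset.mem_range.1 hj), zero_mul]
  simp only [z1, z2, sub_zero] at h1 h2
  have h3 : Tendsto g (𝓝[≠] 0) (𝓝 1) := by
    rw [← hg0]; exact hg.tendsto.mono_left nhdsWithin_le_nhds
  have h4 := (h3.const_mul κ).mul h2
  rw [mul_one] at h4
  refine tendsto_nhds_unique h1 (h4.congr' ?_)
  have hball : Metric.ball (0 : ℝ) 1 ∈ 𝓝[≠] (0 : ℝ) :=
    mem_nhdsWithin_of_mem_nhds (Metric.ball_mem_nhds 0 (by norm_num))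
  filter_upwards [hball] with t ht
  rw [hFH t (by simpa using ht)]
  ring

-- A factor with $g'(0)=0$ does not disturb the first-order coefficient, even when the zeroth ones
-- are nonzero. This covers degree one before the mass is known to vanish.
open Filter Topology in
lemma first_coeff_eq {a c : ℕ → ℝ} {F H g : ℝ → ℝ} {κ : ℝ}
    (hF : ∀ t, |t| < 1 → HasSum (fun k => a k * t ^ k) (F t))
    (hH : ∀ t, |t| < 1 → HasSum (fun k => c k * t ^ k) (H t))
    (hFH : ∀ t, |t| < 1 → F t = κ * g t * H t) (hg0 : g 0 = 1) (hg : HasDerivAt g 0 0) :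
    a 1 = κ * c 1 := by
  have h0 : a 0 = κ * c 0 := leading_coeff_eq hF hH hFH hg0 hg.continuousAt (k := 0)
    (by simp) (by simp)
  have h1 := tendsto_powerSeries_remainder hF 1
  have h2 := tendsto_powerSeries_remainder hH 1
  simp only [Finset.sum_range_one, pow_zero, mul_one, pow_one] at h1 h2
  have h3 : Tendsto g (𝓝[≠] 0) (𝓝 1) := by
    rw [← hg0]; exact hg.continuousAt.tendsto.mono_left nhdsWithin_le_nhds
  have h4 : Tendsto (fun t => (g t - 1) / t) (𝓝[≠] 0) (𝓝 0) := by
    have := hg.tendsto_slope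
    refine this.congr fun t => ?_
    rw [slope_def_field, hg0, sub_zero]
  have h5 := ((h3.const_mul κ).mul h2).add (h4.const_mul (κ * c 0))
  rw [mul_one, mul_zero, add_zero] at h5
  refine tendsto_nhds_unique h1 (h5.congr' ?_)
  have hball : Metric.ball (0 : ℝ) 1 ∈ 𝓝[≠] (0 : ℝ) :=
    mem_nhdsWithin_of_mem_nhds (Metric.ball_mem_nhds 0 (by norm_num))
  filter_upwards [hball] with t ht
  rw [hFH t (by simpa using ht), h0]
  ring

/-! ### The binomial series and its integrated form -/

/-- The coefficients `(σ)_k / k!` of the series of `(1 - y)^(-σ)`. -/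
def binomCoeff (σ : ℝ) (k : ℕ) : ℝ := (ascPochhammer ℝ k).eval σ / k.factorial

lemma binomCoeff_pos {σ : ℝ} (hσ : 0 < σ) (k : ℕ) : 0 < binomCoeff σ k :=
  div_pos (ascPochhammer_pos k σ hσ) (by positivity)

/-- Rising factorials are monotone factor by factor. With $\sigma=\alpha/2$ and $\tau=(4-\alpha)/2$
this is the inequality that excludes moments of degree at least two. -/
lemma binomCoeff_le {σ τ : ℝ} (hσ : 0 < σ) (h : σ ≤ τ) (k : ℕ) :
    binomCoeff σ k ≤ binomCoeff τ k := by
  unfold binomCoeff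
  gcongr
  induction k with
  | zero => simp
  | succ k ih =>
    rw [ascPochhammer_succ_eval, ascPochhammer_succ_eval]
    have := (ascPochhammer_pos k σ hσ).le
    have := (ascPochhammer_pos k τ (hσ.trans_le h)).le
    gcongr

lemma binomCoeff_one (σ : ℝ) : binomCoeff σ 1 = σ := by simp [binomCoeff]

lemma binomCoeff_zero (σ : ℝ) : binomCoeff σ 0 = 1 := by simp [binomCoeff]

lemma binomCoeff_eq_choose (σ : ℝ) (k : ℕ) : Ring.choose (σ + k - 1) k = binomCoeff σ k := by
  have h := Ring.factorial_nsmul_multichoose_eq_ascPochhammer σ k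
  rw [Polynomial.ascPochhammer_smeval_eq_eval, nsmul_eq_mul] at h
  rw [Ring.choose, show σ + k - 1 - k + 1 = σ by ring, binomCoeff, ← h]
  field_simp

lemma hasSum_binomCoeff (σ : ℝ) {y : ℝ} (hy : |y| < 1) :
    HasSum (fun k => binomCoeff σ k * y ^ k) ((1 - y) ^ (-σ)) := by
  have h := (Real.one_div_one_sub_rpow_hasFPowerSeriesOnBall_zero σ).hasSum (y := y)
    (by simpa [← ENNReal.ofReal_one, edist_dist] using hy)
  rw [zero_add, one_div, ← Real.rpow_neg (by linarith [(abs_lt.1 hy).2])] at h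
  have e : (fun k => binomCoeff σ k * y ^ k) = fun k => FormalMultilinearSeries.ofScalars ℝ
      (fun n => Ring.choose (σ + n - 1) n) k fun _ => y := by
    ext k
    simp [FormalMultilinearSeries.ofScalars, binomCoeff_eq_choose]
  rw [e]
  exact h

/-- Since $|u|\le1$ and the coefficients are positive, the binomial series at $|t|$ dominates, and
sum and integral may be exchanged. -/
lemma hasSum_integral_mul_rpow {X : Type*} [MeasurableSpace X] {μ : Measure X} {A u : X → ℝ}
    (hA : Integrable A μ) (hu : AEStronglyMeasurable u μ) (hu1 : ∀ x, |u x| ≤ 1) {σ : ℝ}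
    (hσ : 0 < σ) {t : ℝ} (ht : |t| < 1) :
    HasSum (fun k => binomCoeff σ k * (∫ x, A x * u x ^ k ∂μ) * t ^ k)
      (∫ x, A x * (1 - t * u x) ^ (-σ) ∂μ) := by
  have hint : ∀ k, Integrable (fun x => A x * u x ^ k) μ := fun k =>
    hA.mul_bdd (c := 1) (hu.pow k) (Filter.Eventually.of_forall fun x => by
      rw [norm_pow]; exact pow_le_one₀ (norm_nonneg _) (hu1 x))
  have hbd : ∀ k, ∫ x, ‖binomCoeff σ k * t ^ k * (A x * u x ^ k)‖ ∂μ ≤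
      binomCoeff σ k * |t| ^ k * ∫ x, ‖A x‖ ∂μ := by
    intro k
    rw [← integral_const_mul]
    refine integral_mono ((hint k).const_mul _).norm (hA.norm.const_mul _) fun x => ?_
    simp only [norm_mul, norm_pow, Real.norm_eq_abs, abs_of_pos (binomCoeff_pos hσ k)]
    have : |u x| ^ k ≤ 1 := pow_le_one₀ (abs_nonneg _) (hu1 x)
    have hb := (binomCoeff_pos hσ k).le
    calc binomCoeff σ k * |t| ^ k * (|A x| * |u x| ^ k)
        ≤ binomCoeff σ k * |t| ^ k * (|A x| * 1) := by gcongr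
      _ = _ := by ring
  have hsum : Summable fun k => binomCoeff σ k * |t| ^ k * ∫ x, ‖A x‖ ∂μ :=
    (hasSum_binomCoeff σ (y := |t|) (by rwa [abs_abs])).summable.mul_right _
  have h := hasSum_integral_of_summable_integral_norm
    (fun k => (hint k).const_mul (binomCoeff σ k * t ^ k))
    (Summable.of_nonneg_of_le (fun k => integral_nonneg fun x => norm_nonneg _) hbd hsum)
  have e : ∀ x, ∑' k, binomCoeff σ k * t ^ k * (A x * u x ^ k) =
      A x * (1 - t * u x) ^ (-σ) := by
    intro x
    have h1 : |t * u x| < 1 := by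
      rw [abs_mul]
      calc |t| * |u x| ≤ |t| * 1 := by gcongr; exact hu1 x
        _ < 1 := by linarith
    rw [← ((hasSum_binomCoeff σ h1).mul_left (A x)).tsum_eq]
    exact tsum_congr fun k => by rw [mul_pow]; ring
  simp only [e] at h
  have e' : (fun k => binomCoeff σ k * (∫ x, A x * u x ^ k ∂μ) * t ^ k) =
      fun k => ∫ x, binomCoeff σ k * t ^ k * (A x * u x ^ k) ∂μ := by
    ext k
    rw [integral_const_mul]; ring
  rw [e']
  exact h

/-! ### Bubbles as powers of the weight, and potentials of their conformal images -/

lemma bubbleConst_pos {α : ℝ} (hα : α < 2) : 0 < bubbleConst α := by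
  have h1 : 0 < 2 - α := by linarith
  have h2 : 0 < 4 - α := by linarith
  unfold bubbleConst
  have := Real.pi_pos
  positivity

lemma bubbleConst_rpow {α : ℝ} (hα : α < 2) :
    bubbleConst α ^ ((4 - α) / 2) * bubbleConst α ^ ((4 - α) / 2) =
      (2 - α) * (4 - α) / Real.pi := by
  have h1 : 0 < 2 - α := by linarith
  have h2 : 0 < 4 - α := by linarith
  have hpi := Real.pi_pos
  rw [← Real.rpow_add (bubbleConst_pos hα), add_halves, bubbleConst,
    ← Real.rpow_mul (by positivity), one_div, inv_mul_cancel₀ h2.ne', Real.rpow_one]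

lemma bubble_eq {α : ℝ} (x : Plane) :
    bubble α x = (4 - α) / 2 * Real.log (bubbleConst α * wt x) := by
  simp [bubble, bubbleFamily, wt, div_eq_mul_inv]

lemma exp_bubble {α : ℝ} (hα : α < 2) (x : Plane) :
    Real.exp (bubble α x) = bubbleConst α ^ ((4 - α) / 2) * wt x ^ ((4 - α) / 2) := by
  have hC := bubbleConst_pos hα
  have hw := wt_pos x
  rw [bubble_eq, mul_comm, ← Real.rpow_def_of_pos (by positivity),
    Real.mul_rpow hC.le hw.le]

lemma exp_four_div_bubble {α : ℝ} (hα : α < 2) (x : Plane) :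
    Real.exp (4 / (4 - α) * bubble α x) = bubbleConst α ^ 2 * wt x ^ 2 := by
  have hC := bubbleConst_pos hα
  have hw := wt_pos x
  have h4 : 4 - α ≠ 0 := by linarith
  rw [bubble_eq, show 4 / (4 - α) * ((4 - α) / 2 * Real.log (bubbleConst α * wt x)) =
    Real.log (bubbleConst α * wt x) * 2 by field_simp; norm_num,
    ← Real.rpow_def_of_pos (by positivity), Real.rpow_two, mul_pow]

lemma continuous_exp_bubble {α : ℝ} (hα : α < 2) :
    Continuous fun x => Real.exp (bubble α x) := by
  simp only [exp_bubble hα]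
  exact continuous_const.mul (continuous_wt.rpow_const fun x => Or.inl (wt_pos x).ne')

/-- Divided by `wt`, the left side is a quadratic polynomial in $x$ with leading coefficient $1+tq$;
completing the square gives centre and width. Multiplying $e^U$ by the power $-(4-\alpha)/2$ then
cancels the weight and leaves another bubble. -/
lemma one_sub_mul_sph {p : Plane} {q : ℝ} (h : ‖p‖ ^ 2 + q ^ 2 = 1) {t : ℝ} (ht : |t| < 1)
    (x : Plane) : 0 < 1 + t * q ∧ 1 - t * sph p q x = (1 + t * q) *
      ((√(1 - t ^ 2) / (1 + t * q)) ^ 2 + ‖x - (t / (1 + t * q)) • p‖ ^ 2) * wt x := by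
  have hq : |q| ≤ 1 := by
    rw [← sq_le_one_iff_abs_le_one]; nlinarith [sq_nonneg ‖p‖]
  have htq : |t * q| < 1 := by
    rw [abs_mul]
    calc |t| * |q| ≤ |t| * 1 := by gcongr
      _ < 1 := by linarith
  have hD : 0 < 1 + t * q := by linarith [(abs_lt.1 htq).1]
  refine ⟨hD, ?_⟩
  have ht2 : 0 ≤ 1 - t ^ 2 := by
    have := (sq_lt_one_iff_abs_lt_one t).2 ht
    linarith
  have hw := wt_mul x
  rw [norm_sub_sq_real, inner_smul_right, norm_smul, mul_pow, Real.norm_eq_abs, sq_abs, div_pow,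
    Real.sq_sqrt ht2, real_inner_comm, sph]
  field_simp
  rw [show ‖p‖ ^ 2 = 1 - q ^ 2 by linarith]
  linear_combination (-(1 + t * q)) * hw

/-- The Riesz potential of `e^U (1 - t u)^{-(4-α)/2}` for a linear function `u` on the sphere. -/
lemma riesz_potential_sph {α : ℝ} (hα : α < 2) {p : Plane} {q : ℝ}
    (h : ‖p‖ ^ 2 + q ^ 2 = 1) {t : ℝ} (ht : |t| < 1) (x : Plane) :
    Integrable (fun y => Real.exp (bubble α y) * (1 - t * sph p q y) ^ (-((4 - α) / 2)) /
        ‖x - y‖ ^ α) ∧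
      (∫ y, Real.exp (bubble α y) * (1 - t * sph p q y) ^ (-((4 - α) / 2)) / ‖x - y‖ ^ α) *
        Real.exp (bubble α x) = 2 * (4 - α) * (1 - t ^ 2) ^ (-((2 - α) / 2)) *
          (wt x ^ 2 * (1 - t * sph p q x) ^ (-(α / 2))) := by
  have hC := bubbleConst_pos hα
  have hD := (one_sub_mul_sph h ht 0).1
  have ht2 : 0 < 1 - t ^ 2 := by
    have := (sq_lt_one_iff_abs_lt_one t).2 ht
    linarith
  set D := 1 + t * q with hDdef
  set ζ := (t / D) • p with hζ
  set ρ := √(1 - t ^ 2) / D with hρ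
  have hρ0 : 0 < ρ := div_pos (Real.sqrt_pos.2 ht2) hD
  have hu : ∀ y, 1 - t * sph p q y = D * (ρ ^ 2 + ‖y - ζ‖ ^ 2) * wt y :=
    fun y => (one_sub_mul_sph h ht y).2
  have e : (fun y => Real.exp (bubble α y) * (1 - t * sph p q y) ^ (-((4 - α) / 2)) /
        ‖x - y‖ ^ α) = fun y => bubbleConst α ^ ((4 - α) / 2) * D ^ (-((4 - α) / 2)) *
          ((ρ ^ 2 + ‖y - ζ‖ ^ 2) ^ (-((4 - α) / 2)) / ‖x - y‖ ^ α) := by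
    ext y
    have hw := wt_pos y
    have hr : 0 < ρ ^ 2 + ‖y - ζ‖ ^ 2 := by positivity
    rw [hu, exp_bubble hα, Real.mul_rpow (by positivity) hw.le, Real.mul_rpow hD.le hr.le,
      Real.rpow_neg hw.le]
    have : wt y ^ ((4 - α) / 2) ≠ 0 := (Real.rpow_pos_of_pos hw _).ne'
    field_simp
  obtain ⟨hi, hv⟩ := riesz_potential_bubble hα x ζ hρ0
  rw [e]
  refine ⟨hi.const_mul _, ?_⟩
  rw [integral_const_mul, hv, exp_bubble hα, hu]
  have hw := wt_pos x
  have hr : 0 < ρ ^ 2 + ‖x - ζ‖ ^ 2 := by positivity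
  have hC2 := bubbleConst_rpow hα
  rw [Real.mul_rpow (by positivity) hw.le, Real.mul_rpow hD.le hr.le]
  have e1 : ρ ^ (α - 2) = (1 - t ^ 2) ^ (-((2 - α) / 2)) * D ^ (2 - α) := by
    rw [hρ, Real.div_rpow (Real.sqrt_nonneg _) hD.le, Real.sqrt_eq_rpow, ← Real.rpow_mul ht2.le,
      div_eq_mul_inv, ← Real.rpow_neg hD.le]
    congr 2 <;> ring
  have e2 : wt x ^ 2 * wt x ^ (-(α / 2)) = wt x ^ ((4 - α) / 2) := by
    rw [← Real.rpow_two, ← Real.rpow_add hw]; congr 1; ring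
  have e3 : D ^ (-((4 - α) / 2)) * D ^ (2 - α) = D ^ (-(α / 2)) := by
    rw [← Real.rpow_add hD]; congr 1; ring
  rw [e1, ← e2, ← e3]
  have h2 : 2 - α ≠ 0 := by linarith
  have hpi := Real.pi_pos.ne'
  calc _ = bubbleConst α ^ ((4 - α) / 2) * bubbleConst α ^ ((4 - α) / 2) *
        (2 * Real.pi / (2 - α)) * (D ^ (-((4 - α) / 2)) * D ^ (2 - α) *
          (1 - t ^ 2) ^ (-((2 - α) / 2)) * (ρ ^ 2 + ‖x - ζ‖ ^ 2) ^ (-(α / 2)) *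
          (wt x ^ 2 * wt x ^ (-(α / 2)))) := by ring
    _ = _ := by
      -- The normalization of $C_\alpha$ cancels the constant $2\pi/(2-\alpha)$ of the potential,
      -- leaving $2(4-\alpha)$.
      rw [hC2]
      field_simp

lemma riesz_potential_exp_bubble {α : ℝ} (hα : α < 2) (x : Plane) :
    Integrable (fun y => Real.exp (bubble α y) / ‖x - y‖ ^ α) ∧
      (∫ y, Real.exp (bubble α y) / ‖x - y‖ ^ α) * Real.exp (bubble α x) =
        2 * (4 - α) * wt x ^ 2 := by
  -- At $t=0$ the direction is irrelevant; any unit vector would do.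
  have h := riesz_potential_sph hα (p := 0) (q := 1) (by simp) (t := 0) (by simp) x
  simpa using h

/-! ### The nonlocal term: integrability, symmetry and generating identity -/

/-- The nonlocal part of the linearized operator. -/
def rieszTerm (α : ℝ) (φ : Plane → ℝ) (x : Plane) : ℝ :=
  (∫ y, Real.exp (bubble α y) * φ y / ‖x - y‖ ^ α) * Real.exp (bubble α x)

lemma linearizedRHS_eq {α : ℝ} (hα : α < 2) (φ : Plane → ℝ) (x : Plane) :
    linearizedRHS α φ x = rieszTerm α φ x + 2 * (4 - α) * (φ x * wt x ^ 2) := by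
  rw [linearizedRHS, (riesz_potential_exp_bubble hα x).2, rieszTerm]
  ring

lemma aestronglyMeasurable_of_mul_wt_sq {φ : Plane → ℝ}
    (hφ : Integrable fun x => φ x * wt x ^ 2) : AEStronglyMeasurable φ volume := by
  have h1 : Continuous fun x : Plane => (1 + ‖x‖ ^ 2) ^ 2 := by fun_prop
  refine (hφ.aestronglyMeasurable.mul h1.aestronglyMeasurable).congr
    (Filter.Eventually.of_forall fun x => ?_)
  simp only [Pi.mul_apply]
  rw [mul_assoc, ← mul_pow, wt_mul, one_pow, mul_one]

/-- Tonelli: integrating the absolute value in $x$ first produces the potential of $e^U$, hence a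
multiple of $|\varphi|\,\mathrm{wt}^2$. -/
lemma integrable_riesz_kernel {α : ℝ} (hα : α < 2) {φ : Plane → ℝ}
    (hφ : Integrable fun x => φ x * wt x ^ 2) :
    Integrable (fun z : Plane × Plane => Real.exp (bubble α z.2) * φ z.2 / ‖z.1 - z.2‖ ^ α *
      Real.exp (bubble α z.1)) (volume.prod volume) := by
  have hφm := aestronglyMeasurable_of_mul_wt_sq hφ
  have hk : ∀ y : Plane, ∀ x, ‖Real.exp (bubble α y) * φ y / ‖x - y‖ ^ α *
      Real.exp (bubble α x)‖ = |φ y| * Real.exp (bubble α y) *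
        (Real.exp (bubble α x) / ‖y - x‖ ^ α) := by
    intro y x
    rw [norm_mul, norm_div, norm_mul, Real.norm_of_nonneg (Real.exp_pos _).le,
      Real.norm_of_nonneg (Real.exp_pos _).le,
      Real.norm_of_nonneg (Real.rpow_nonneg (norm_nonneg (x - y)) α), Real.norm_eq_abs,
      norm_sub_rev]
    ring
  have hm1 : Measurable fun z : Plane × Plane => Real.exp (bubble α z.2) / ‖z.1 - z.2‖ ^ α *
      Real.exp (bubble α z.1) := by
    have hc := (continuous_exp_bubble hα).measurable
    have hn : Measurable fun z : Plane × Plane => ‖z.1 - z.2‖ :=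
      (measurable_fst.sub measurable_snd).norm
    exact ((hc.comp measurable_snd).div (hn.pow_const α)).mul (hc.comp measurable_fst)
  have hm : AEStronglyMeasurable (fun z : Plane × Plane =>
      Real.exp (bubble α z.2) * φ z.2 / ‖z.1 - z.2‖ ^ α * Real.exp (bubble α z.1))
      (volume.prod volume) := by
    refine (hm1.aestronglyMeasurable.mul (hφm.comp_snd (μ := volume))).congr
      (Filter.Eventually.of_forall fun z => ?_)
    simp only [Pi.mul_apply]
    ring
  rw [integrable_prod_iff' hm]
  constructor
  · refine Filter.Eventually.of_forall fun y => ?_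
    have hi := (riesz_potential_exp_bubble hα y).1.const_mul (φ y * Real.exp (bubble α y))
    refine hi.congr (Filter.Eventually.of_forall fun x => ?_)
    simp only [norm_sub_rev y x]
    ring
  · have : (fun y => ∫ x, ‖Real.exp (bubble α y) * φ y / ‖x - y‖ ^ α * Real.exp (bubble α x)‖) =
        fun y => 2 * (4 - α) * ‖φ y * wt y ^ 2‖ := by
      ext y
      simp only [hk]
      have hv := (riesz_potential_exp_bubble hα y).2
      rw [integral_const_mul, norm_mul, Real.norm_of_nonneg (sq_nonneg (wt y)), Real.norm_eq_abs]
      calc _ = |φ y| * ((∫ x, Real.exp (bubble α x) / ‖y - x‖ ^ α) * Real.exp (bubble α y)) := by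
            ring
        _ = _ := by rw [hv]; ring
    simp only [this]
    exact hφ.norm.const_mul _

lemma integrable_rieszTerm {α : ℝ} (hα : α < 2) {φ : Plane → ℝ}
    (hφ : Integrable fun x => φ x * wt x ^ 2) : Integrable (rieszTerm α φ) := by
  have h := (integrable_riesz_kernel hα hφ).integral_prod_left
  refine h.congr (Filter.Eventually.of_forall fun x => ?_)
  simp only [rieszTerm]
  rw [integral_mul_const]

lemma integral_rieszTerm_mul {α : ℝ} (hα : α < 2) {φ G : Plane → ℝ}
    (hφ : Integrable fun x => φ x * wt x ^ 2) (hG : AEStronglyMeasurable G volume) {M : ℝ}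
    (hM : ∀ x, |G x| ≤ M) :
    ∫ x, rieszTerm α φ x * G x = ∫ y, φ y * rieszTerm α G y := by
  have hint : Integrable (fun z : Plane × Plane => Real.exp (bubble α z.2) * φ z.2 /
      ‖z.1 - z.2‖ ^ α * Real.exp (bubble α z.1) * G z.1) (volume.prod volume) :=
    (integrable_riesz_kernel hα hφ).mul_bdd (c := M) hG.comp_fst
      (Filter.Eventually.of_forall fun z => hM z.1)
  calc ∫ x, rieszTerm α φ x * G x = ∫ x, ∫ y, Real.exp (bubble α y) * φ y /
      ‖x - y‖ ^ α * Real.exp (bubble α x) * G x := by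
        simp only [rieszTerm, integral_mul_const]
    _ = ∫ y, ∫ x, Real.exp (bubble α y) * φ y /
      ‖x - y‖ ^ α * Real.exp (bubble α x) * G x := integral_integral_swap hint
    _ = _ := by
      refine integral_congr_ae (Filter.Eventually.of_forall fun y => ?_)
      simp only [rieszTerm]
      rw [← integral_mul_const, ← integral_const_mul]
      refine integral_congr_ae (Filter.Eventually.of_forall fun x => ?_)
      simp only [norm_sub_rev y x]
      ring

lemma one_sub_mul_sph_pos {p : Plane} {q : ℝ} (h : ‖p‖ ^ 2 + q ^ 2 = 1) {t : ℝ} (ht : |t| < 1)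
    (x : Plane) : 0 < 1 - |t| ∧ 1 - |t| ≤ 1 - t * sph p q x := by
  refine ⟨by linarith, ?_⟩
  have h1 : |t * sph p q x| ≤ |t| := by
    rw [abs_mul]
    exact mul_le_of_le_one_right (abs_nonneg t) (abs_sph_le_one h x)
  linarith [le_abs_self (t * sph p q x)]

/-- The generating identity for the moments of the nonlocal term. -/
lemma integral_rieszTerm_mul_rpow {α : ℝ} (hα : α < 2) {φ : Plane → ℝ}
    (hφ : Integrable fun x => φ x * wt x ^ 2) {p : Plane} {q : ℝ}
    (h : ‖p‖ ^ 2 + q ^ 2 = 1) {t : ℝ} (ht : |t| < 1) :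
    ∫ x, rieszTerm α φ x * (1 - t * sph p q x) ^ (-((4 - α) / 2)) =
      2 * (4 - α) * (1 - t ^ 2) ^ (-((2 - α) / 2)) *
        ∫ x, (φ x * wt x ^ 2) * (1 - t * sph p q x) ^ (-(α / 2)) := by
  have hc : Continuous fun x => (1 - t * sph p q x) ^ (-((4 - α) / 2)) :=
    (continuous_const.sub (continuous_const.mul (continuous_sph p q))).rpow_const fun x =>
      Or.inl ((one_sub_mul_sph_pos h ht x).1.trans_le (one_sub_mul_sph_pos h ht x).2).ne'
  -- By symmetry the potential is moved from $\varphi$ to the explicit function, where it is known.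
  rw [integral_rieszTerm_mul hα hφ hc.aestronglyMeasurable (M := (1 - |t|) ^ (-((4 - α) / 2))),
    ← integral_const_mul]
  · refine integral_congr_ae (Filter.Eventually.of_forall fun x => ?_)
    simp only [rieszTerm]
    rw [(riesz_potential_sph hα h ht x).2]
    ring
  · intro x
    obtain ⟨h1, h2⟩ := one_sub_mul_sph_pos h ht x
    rw [abs_of_nonneg (Real.rpow_nonneg (h1.le.trans h2) _)]
    exact Real.rpow_le_rpow_of_nonpos h1 h2 (by linarith)

lemma hasDerivAt_one_sub_sq_rpow (β : ℝ) : HasDerivAt (fun t : ℝ => (1 - t ^ 2) ^ β) 0 0 := by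
  have h1 : HasDerivAt (fun t : ℝ => 1 - t ^ 2) 0 0 := by
    simpa using (hasDerivAt_pow 2 (0 : ℝ)).const_sub 1
  simpa using h1.rpow_const (p := β) (Or.inl (by norm_num))

/-- Linear functions on the sphere are eigenfunctions of the nonlocal term. -/
lemma rieszTerm_sph_of_unit {α : ℝ} (hα : α < 2) {p : Plane} {q : ℝ}
    (h : ‖p‖ ^ 2 + q ^ 2 = 1) (x : Plane) :
    rieszTerm α (sph p q) x = 2 * α * (wt x ^ 2 * sph p q x) := by
  have hA := (riesz_potential_exp_bubble hα x).1.mul_const (Real.exp (bubble α x))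
  have hs : 0 < (4 - α) / 2 := by linarith
  have key := first_coeff_eq (κ := 2 * (4 - α)) (g := fun t => (1 - t ^ 2) ^ (-((2 - α) / 2)))
    (fun t ht => hasSum_integral_mul_rpow hA (continuous_sph p q).aestronglyMeasurable
      (abs_sph_le_one h) hs ht)
    (H := fun t => wt x ^ 2 * (1 - t * sph p q x) ^ (-(α / 2)))
    (c := fun k => wt x ^ 2 * (binomCoeff (α / 2) k * sph p q x ^ k))
    (fun t ht => by
      have h1 : |t * sph p q x| < 1 := by
        rw [abs_mul]
        exact (mul_le_of_le_one_right (abs_nonneg t) (abs_sph_le_one h x)).trans_lt ht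
      refine ((hasSum_binomCoeff (α / 2) h1).mul_left (wt x ^ 2)).congr_fun fun k => ?_
      rw [mul_pow]; ring)
    (fun t ht => by
      rw [← (riesz_potential_sph hα h ht x).2, ← integral_mul_const]
      refine integral_congr_ae (Filter.Eventually.of_forall fun y => ?_)
      simp only
      ring)
    (by simp) (hasDerivAt_one_sub_sq_rpow _)
  simp only [binomCoeff_one, pow_one] at key
  have e : rieszTerm α (sph p q) x = ∫ y, Real.exp (bubble α y) / ‖x - y‖ ^ α *
      Real.exp (bubble α x) * sph p q y := by
    rw [rieszTerm, ← integral_mul_const]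
    refine integral_congr_ae (Filter.Eventually.of_forall fun y => ?_)
    simp only
    ring
  rw [e]
  have h4 : (4 - α) ≠ 0 := by linarith
  set I := ∫ y, Real.exp (bubble α y) / ‖x - y‖ ^ α * Real.exp (bubble α x) * sph p q y
  field_simp at key
  linear_combination key

/-! ### Elementary consequences of the weighted bound -/

lemma MemL2w.mul_wt {φ : Plane → ℝ} (hφ : MemL2w φ) :
    MemLp (fun x => φ x * wt x) 2 volume := by
  simpa [MemL2w, div_eq_mul_inv, wt] using hφ

lemma integrable_wt_sq : Integrable fun x : Plane => wt x ^ 2 := by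
  simpa using integrable_wt_rpow (p := 2) (by norm_num)

lemma memLp_wt : MemLp wt 2 volume :=
  (memLp_two_iff_integrable_sq continuous_wt.aestronglyMeasurable).2 integrable_wt_sq

lemma MemL2w.integrable_mul_wt_sq {φ : Plane → ℝ} (hφ : MemL2w φ) :
    Integrable fun x => φ x * wt x ^ 2 := by
  have h := hφ.mul_wt.integrable_mul memLp_wt
  refine h.congr (Filter.Eventually.of_forall fun x => ?_)
  simp only [Pi.mul_apply]
  ring

lemma MemL2w.aestronglyMeasurable {φ : Plane → ℝ} (hφ : MemL2w φ) :
    AEStronglyMeasurable φ volume :=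
  aestronglyMeasurable_of_mul_wt_sq hφ.integrable_mul_wt_sq

/-! ### Cutoffs and the enlarged class of test functions -/

/-- The annulus `R ≤ |x| ≤ 2R`. -/
def annulus (R : ℝ) : Set Plane := {x | R ≤ ‖x‖ ∧ ‖x‖ ≤ 2 * R}

lemma measurableSet_annulus (R : ℝ) : MeasurableSet (annulus R) :=
  (measurableSet_le measurable_const measurable_norm).inter
    (measurableSet_le measurable_norm measurable_const)

lemma annulus_subset (R : ℝ) : annulus R ⊆ Metric.closedBall 0 (2 * R) := fun x hx => by
  simpa using hx.2

lemma measureReal_closedBall {R : ℝ} (hR : 0 ≤ R) :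
    (volume : Measure Plane).real (Metric.closedBall 0 R) = R ^ 2 * Real.pi := by
  simp [Measure.real, hR, Real.pi_pos.le]

lemma measureReal_annulus_le {R : ℝ} (hR : 0 ≤ R) :
    (volume : Measure Plane).real (annulus R) ≤ 4 * Real.pi * R ^ 2 := by
  calc (volume : Measure Plane).real (annulus R)
      ≤ (volume : Measure Plane).real (Metric.closedBall 0 (2 * R)) :=
        measureReal_mono (annulus_subset R) measure_closedBall_lt_top.ne
    _ = _ := by rw [measureReal_closedBall (by positivity)]; ring

lemma measure_annulus_ne_top (R : ℝ) : (volume : Measure Plane) (annulus R) ≠ ⊤ :=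
  ((measure_mono (annulus_subset R)).trans_lt measure_closedBall_lt_top).ne

/-- Cauchy–Schwarz; the area of the annulus, of order $R^2$, balances the factor $R^{-2}$ exactly.
-/
lemma setIntegral_annulus_le {Φ : Plane → ℝ} (hΦ : MemLp Φ 2 volume) {R : ℝ} (hR : 0 < R) :
    ∫ x in annulus R, |Φ x| * R⁻¹ ≤ √(∫ x in annulus R, Φ x ^ 2) * √(4 * Real.pi) := by
  have h2 : (2 : ℝ).HolderConjugate 2 := Real.HolderConjugate.two_two
  have : IsFiniteMeasure ((volume : Measure Plane).restrict (annulus R)) :=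
    ⟨by simpa using (measure_annulus_ne_top R).lt_top⟩
  have h := integral_mul_le_Lp_mul_Lq_of_nonneg (μ := volume.restrict (annulus R)) h2
    (f := fun x => |Φ x|) (g := fun _ => R⁻¹) (Filter.Eventually.of_forall fun x => abs_nonneg _)
    (Filter.Eventually.of_forall fun x => by positivity)
    (by rw [ENNReal.ofReal_ofNat]; exact (hΦ.restrict _).abs) (memLp_const _)
  refine h.trans ?_
  simp only [Real.rpow_two, sq_abs, ← Real.sqrt_eq_rpow]
  gcongr
  rw [setIntegral_const, smul_eq_mul]
  calc _ ≤ 4 * Real.pi * R ^ 2 * R⁻¹ ^ 2 := by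
        gcongr; exact measureReal_annulus_le hR.le
    _ = 4 * Real.pi := by field_simp

open Filter Topology in
/-- The mean of an `L²` function over annuli of radius `R`, at the scale `1 / R`, tends to `0`. -/
lemma tendsto_setIntegral_annulus {Φ : Plane → ℝ} (hΦ : MemLp Φ 2 volume) :
    Tendsto (fun n : ℕ => ∫ x in annulus (n + 1), |Φ x| * (n + 1 : ℝ)⁻¹) atTop (𝓝 0) := by
  have hsq : Integrable fun x => Φ x ^ 2 := hΦ.integrable_sq
  have hτ : Tendsto (fun n : ℕ => ∫ x in annulus (n + 1), Φ x ^ 2) atTop (𝓝 0) := by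
    simp only [← integral_indicator (measurableSet_annulus _)]
    rw [← integral_zero Plane ℝ (μ := volume)]
    refine tendsto_integral_of_dominated_convergence (fun x => Φ x ^ 2)
      (fun n => hsq.aestronglyMeasurable.indicator (measurableSet_annulus _)) hsq
      (fun n => Eventually.of_forall fun x => ?_) (Eventually.of_forall fun x => ?_)
    · refine (norm_indicator_le_norm_self _ _).trans ?_
      rw [Real.norm_of_nonneg (sq_nonneg _)]
    · refine tendsto_const_nhds.congr' ?_
      obtain ⟨N, hN⟩ := exists_nat_ge ‖x‖
      filter_upwards [eventually_ge_atTop N] with n hn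
      rw [Set.indicator_of_notMem]
      intro hx
      have h1 : (N : ℝ) ≤ n := by exact_mod_cast hn
      have := hx.1
      linarith
  refine squeeze_zero (fun n => integral_nonneg fun x => by positivity)
    (fun n => setIntegral_annulus_le hΦ (by positivity)) ?_
  have h := (((Real.continuous_sqrt.tendsto 0).comp hτ).mul_const (√(4 * Real.pi)))
  simpa using h

lemma pd_comp_smul {f : Plane → ℝ} (hf : Differentiable ℝ f) (c : ℝ) (j : Fin 2) :
    pd j (fun x => f (c • x)) = fun x => c * pd j f (c • x) := by
  ext x
  have h1 : HasFDerivAt (fun x : Plane => c • x) (c • ContinuousLinearMap.id ℝ Plane) x :=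
    (hasFDerivAt_id x).const_smul c
  have h2 := (hf (c • x)).hasFDerivAt.comp x h1
  rw [pd, show (fun x => f (c • x)) = f ∘ fun x => c • x from rfl, h2.fderiv]
  simp [pd]

lemma laplacian_comp_smul {f : Plane → ℝ} (hf : ContDiff ℝ 2 f) (c : ℝ) (x : Plane) :
    (Δ (fun x => f (c • x))) x = c ^ 2 * (Δ f) (c • x) := by
  have hc : ContDiff ℝ 2 fun x : Plane => f (c • x) := hf.comp (contDiff_const_smul c)
  rw [laplacian_eq_sum_pd hc, laplacian_eq_sum_pd hf, Finset.mul_sum]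
  refine Finset.sum_congr rfl fun j _ => ?_
  have d1 := hf.differentiable (by norm_num)
  have d2 := (hf.pd (m := 1) (by norm_num) j).differentiable (by norm_num)
  have d3 : Differentiable ℝ fun x : Plane => pd j f (c • x) :=
    d2.comp (differentiable_id.const_smul c)
  rw [pd_comp_smul d1, pd_const_mul c d3, pd_comp_smul d2]
  ring

lemma continuous_laplacian {f : Plane → ℝ} (hf : ContDiff ℝ 2 f) : Continuous (Δ f) := by
  rw [show Δ f = fun x => ∑ j, pd j (pd j f) x from funext (laplacian_eq_sum_pd hf)]
  exact continuous_finsetSum _ fun j _ =>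
    ((hf.pd (m := 1) (by norm_num) j).pd (m := 0) (by norm_num) j).continuous

lemma pd_eq_zero_of_eventuallyEq_const {f : Plane → ℝ} {x : Plane} {c : ℝ}
    (h : f =ᶠ[nhds x] fun _ => c) (j : Fin 2) : pd j f x = 0 := by
  rw [pd, h.fderiv_eq]; simp

lemma laplacian_eq_zero_of_eventuallyEq_const {f : Plane → ℝ} {x : Plane} {c : ℝ}
    (h : f =ᶠ[nhds x] fun _ => c) : (Δ f) x = 0 := by
  have h1 := (InnerProductSpace.laplacian_congr_nhds h).self_of_nhds
  rw [h1]; simp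

/-- A fixed cutoff function, equal to `1` on the unit ball and supported in the ball of
radius `2`. -/
def cutoff : ContDiffBump (0 : Plane) := ⟨1, 2, by norm_num, by norm_num⟩

lemma cutoff_eventuallyEq_const {x : Plane} (hx : ¬ (1 ≤ ‖x‖ ∧ ‖x‖ ≤ 2)) :
    ∃ c : ℝ, (cutoff : Plane → ℝ) =ᶠ[nhds x] fun _ => c := by
  by_cases h1 : ‖x‖ < 1
  · refine ⟨1, cutoff.eventuallyEq_one_of_mem_ball ?_⟩
    simpa [cutoff] using h1
  · refine ⟨0, ?_⟩
    have h2 : 2 < ‖x‖ := by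
      by_contra h
      exact hx ⟨not_lt.1 h1, not_lt.1 h⟩
    have : x ∉ tsupport (cutoff : Plane → ℝ) := by
      rw [cutoff.tsupport_eq]
      simpa [cutoff] using h2
    exact notMem_tsupport_iff_eventuallyEq.1 this

lemma exists_cutoff_bound : ∃ B : ℝ, 0 ≤ B ∧ (∀ x j, |pd j (cutoff : Plane → ℝ) x| ≤ B) ∧
    ∀ x, |(Δ (cutoff : Plane → ℝ)) x| ≤ B := by
  have hc : ContDiff ℝ 2 (cutoff : Plane → ℝ) := cutoff.contDiff
  have bd : ∀ g : Plane → ℝ, Continuous g → (∀ x, ¬ (1 ≤ ‖x‖ ∧ ‖x‖ ≤ 2) → g x = 0) →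
      ∃ B, 0 ≤ B ∧ ∀ x, |g x| ≤ B := by
    intro g hg h0
    obtain ⟨B, hB⟩ := (isCompact_closedBall (0 : Plane) 2).exists_bound_of_continuousOn
      hg.continuousOn
    refine ⟨max B 0, le_max_right _ _, fun x => ?_⟩
    by_cases hx : 1 ≤ ‖x‖ ∧ ‖x‖ ≤ 2
    · exact (hB x (by simpa using hx.2)).trans (le_max_left _ _)
    · rw [h0 x hx]; simp
  have hp : ∀ j, ∃ B, 0 ≤ B ∧ ∀ x, |pd j (cutoff : Plane → ℝ) x| ≤ B := fun j =>
    bd _ (hc.pd (m := 1) (by norm_num) j).continuous fun x hx => by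
      obtain ⟨c, h⟩ := cutoff_eventuallyEq_const hx
      exact pd_eq_zero_of_eventuallyEq_const h j
  obtain ⟨B, hB0, hB⟩ := bd _ (continuous_laplacian hc) fun x hx => by
    obtain ⟨c, h⟩ := cutoff_eventuallyEq_const hx
    exact laplacian_eq_zero_of_eventuallyEq_const h
  choose b hb0 hb using hp
  refine ⟨B + ∑ j, b j, add_nonneg hB0 (Finset.sum_nonneg fun j _ => hb0 j),
    fun x j => (hb j x).trans ?_, fun x => (hB x).trans ?_⟩
  · have := Finset.single_le_sum (fun j _ => hb0 j) (Finset.mem_univ j)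
    linarith
  · have := Finset.sum_nonneg (s := Finset.univ) fun j _ => hb0 j
    linarith

/-- The error term in `Δ (ψ χ)` for the cutoff `χ` at scale `R`. -/
def cutoffError (ψ : Plane → ℝ) (R : ℝ) (x : Plane) : ℝ :=
  ψ x * (Δ fun x => cutoff (R⁻¹ • x)) x +
    2 * ∑ j, pd j ψ x * pd j (fun x => cutoff (R⁻¹ • x)) x

lemma contDiff_cutoff_smul {n : ℕ∞} (R : ℝ) :
    ContDiff ℝ n fun x : Plane => cutoff (R⁻¹ • x) :=
  cutoff.contDiff.comp (contDiff_const_smul _)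

lemma cutoffError_eq_zero (ψ : Plane → ℝ) {R : ℝ} (hR : 0 < R) {x : Plane} (hx : x ∉ annulus R) :
    cutoffError ψ R x = 0 := by
  have h1 : ¬ (1 ≤ ‖R⁻¹ • x‖ ∧ ‖R⁻¹ • x‖ ≤ 2) := by
    intro h
    rw [norm_smul, Real.norm_of_nonneg (by positivity), inv_mul_eq_div, le_div_iff₀ hR,
      div_le_iff₀ hR, one_mul] at h
    exact hx h
  obtain ⟨c, hc⟩ := cutoff_eventuallyEq_const h1
  have h2 : (fun x : Plane => cutoff (R⁻¹ • x)) =ᶠ[nhds x] fun _ => c :=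
    ((continuous_const_smul R⁻¹).tendsto x).eventually hc
  simp [cutoffError, laplacian_eq_zero_of_eventuallyEq_const h2,
    pd_eq_zero_of_eventuallyEq_const h2]

/-- On the annulus $R^{-1}\le3\,\mathrm{wt}^{1/2}$, so $|\psi|R^{-2}$ and $|\nabla\psi|R^{-1}$ are
both of order $\mathrm{wt}\,R^{-1}$. A nonzero limit of $\psi$ at infinity would lose a factor $R$,
which is why constants have to be subtracted from test functions. -/
lemma exists_abs_cutoffError_le {ψ : Plane → ℝ} {M : ℝ} (hM : 0 ≤ M)
    (h0 : ∀ x, ψ x ^ 2 ≤ M ^ 2 * wt x) (h1 : ∀ x j, |pd j ψ x| ≤ M * wt x) :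
    ∃ B, 0 ≤ B ∧ ∀ R, 1 ≤ R → ∀ x ∈ annulus R, |cutoffError ψ R x| ≤ B * (wt x * R⁻¹) := by
  obtain ⟨B, hB0, hB1, hB2⟩ := exists_cutoff_bound
  refine ⟨7 * M * B, by positivity, fun R hR x hx => ?_⟩
  have hR0 : 0 < R := by linarith
  have hw := wt_pos x
  have hRw : R⁻¹ ^ 2 ≤ 9 * wt x := by
    rw [wt, inv_pow, ← div_eq_mul_inv, le_div_iff₀ (by positivity), inv_mul_le_iff₀ (by positivity)]
    have := hx.2
    nlinarith [norm_nonneg x]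
  have hψ : |ψ x| * R⁻¹ ≤ 3 * M * wt x := by
    refine abs_le_of_sq_le_sq' ?_ (by positivity) |>.2
    calc (|ψ x| * R⁻¹) ^ 2 = ψ x ^ 2 * R⁻¹ ^ 2 := by rw [mul_pow, sq_abs]
      _ ≤ M ^ 2 * wt x * (9 * wt x) := by gcongr; exact h0 x
      _ = _ := by ring
  have e1 : |ψ x * (Δ fun x => cutoff (R⁻¹ • x)) x| ≤ 3 * M * B * (wt x * R⁻¹) := by
    rw [laplacian_comp_smul cutoff.contDiff, abs_mul, abs_mul, abs_of_nonneg (sq_nonneg R⁻¹)]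
    calc |ψ x| * (R⁻¹ ^ 2 * |(Δ (cutoff : Plane → ℝ)) (R⁻¹ • x)|)
        ≤ |ψ x| * (R⁻¹ ^ 2 * B) := by gcongr; exact hB2 _
      _ = |ψ x| * R⁻¹ * (R⁻¹ * B) := by ring
      _ ≤ 3 * M * wt x * (R⁻¹ * B) := by gcongr
      _ = _ := by ring
  have e2 : ∀ j, |pd j ψ x * pd j (fun x => cutoff (R⁻¹ • x)) x| ≤ M * B * (wt x * R⁻¹) := by
    intro j
    rw [pd_comp_smul (cutoff.contDiff.differentiable (n := 1) (by norm_num)), abs_mul, abs_mul,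
      abs_of_nonneg (by positivity : 0 ≤ R⁻¹)]
    calc |pd j ψ x| * (R⁻¹ * |pd j (cutoff : Plane → ℝ) (R⁻¹ • x)|)
        ≤ M * wt x * (R⁻¹ * B) := by gcongr; exacts [h1 x j, hB1 _ j]
      _ = _ := by ring
  rw [cutoffError, Fin.sum_univ_two]
  have t1 := abs_add_le (pd 0 ψ x * pd 0 (fun x => cutoff (R⁻¹ • x)) x)
    (pd 1 ψ x * pd 1 (fun x => cutoff (R⁻¹ • x)) x)
  refine (abs_add_le _ _).trans ?_
  rw [abs_mul 2, abs_two]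
  linarith [e1, e2 0, e2 1]

open Filter Topology in
/-- The weak equation may be tested with smooth functions vanishing at infinity, in the sense of
functions on the sphere. -/
theorem IsDistributionalSolution.extend {φ f ψ : Plane → ℝ} (hφ : MemL2w φ) (hf : Integrable f)
    (hsol : IsDistributionalSolution φ f) (hψ : ContDiff ℝ ∞ ψ) {M : ℝ} (hM : 0 ≤ M)
    (h0 : ∀ x, ψ x ^ 2 ≤ M ^ 2 * wt x) (h1 : ∀ x j, |pd j ψ x| ≤ M * wt x)
    (h2 : ∀ x, |(Δ ψ) x| ≤ M * wt x ^ 2) :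
    -∫ x, φ x * (Δ ψ) x = ∫ x, f x * ψ x := by
  have hψ2 : ContDiff ℝ 2 ψ := hψ.of_le ENat.LEInfty.out
  have hφm := hφ.aestronglyMeasurable
  let χ : ℕ → Plane → ℝ := fun n x => cutoff ((n + 1 : ℝ)⁻¹ • x)
  have hχc : ∀ n, Continuous (χ n) := fun n => (contDiff_cutoff_smul (n := 0) _).continuous
  have hχ1 : ∀ n x, ‖χ n x‖ ≤ 1 := fun n x => by
    rw [Real.norm_of_nonneg cutoff.nonneg]; exact cutoff.le_one
  have hχt : ∀ x, Tendsto (fun n => χ n x) atTop (𝓝 1) := by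
    intro x
    refine tendsto_const_nhds.congr' ?_
    obtain ⟨N, hN⟩ := exists_nat_ge ‖x‖
    filter_upwards [eventually_ge_atTop N] with n hn
    refine (cutoff.one_of_mem_closedBall ?_).symm
    have h1 : (N : ℝ) ≤ n := by exact_mod_cast hn
    have hn0 : (0 : ℝ) < n + 1 := by positivity
    rw [mem_closedBall_zero_iff, norm_smul, Real.norm_of_nonneg (by positivity), inv_mul_eq_div,
      div_le_iff₀ hn0]
    change ‖x‖ ≤ 1 * _
    linarith
  have lim : ∀ g : Plane → ℝ, Integrable g →
      Tendsto (fun n => ∫ x, g x * χ n x) atTop (𝓝 (∫ x, g x)) := by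
    intro g hg
    refine tendsto_integral_of_dominated_convergence (fun x => ‖g x‖)
      (fun n => hg.aestronglyMeasurable.mul (hχc n).aestronglyMeasurable) hg.norm
      (fun n => Eventually.of_forall fun x => ?_) (Eventually.of_forall fun x => ?_)
    · rw [norm_mul]; exact mul_le_of_le_one_right (norm_nonneg _) (hχ1 n x)
    · simpa using (hχt x).const_mul (g x)
  have hΔc := continuous_laplacian hψ2
  have i1 : Integrable fun x => φ x * (Δ ψ) x := by
    refine (hφ.integrable_mul_wt_sq.norm.const_mul M).mono'
      (hφm.mul hΔc.aestronglyMeasurable) (Eventually.of_forall fun x => ?_)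
    rw [norm_mul, norm_mul, Real.norm_of_nonneg (sq_nonneg (wt x))]
    calc ‖φ x‖ * ‖(Δ ψ) x‖ ≤ ‖φ x‖ * (M * wt x ^ 2) := by gcongr; exact h2 x
      _ = _ := by ring
  have i2 : Integrable fun x => f x * ψ x := by
    refine hf.mul_bdd (c := M) hψ.continuous.aestronglyMeasurable
      (Eventually.of_forall fun x => ?_)
    refine abs_le_of_sq_le_sq ((h0 x).trans ?_) hM
    exact mul_le_of_le_one_right (sq_nonneg M) (wt_le_one x)
  obtain ⟨B, hB0, hB⟩ := exists_abs_cutoffError_le hM h0 h1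
  have hdom : ∀ (n : ℕ) x, ‖φ x * cutoffError ψ (n + 1) x‖ ≤
      (annulus (n + 1)).indicator (fun x => B * (|φ x * wt x| * (n + 1 : ℝ)⁻¹)) x := by
    intro n x
    by_cases hx : x ∈ annulus (n + 1)
    · rw [Set.indicator_of_mem hx, norm_mul, abs_mul, abs_of_pos (wt_pos x)]
      calc ‖φ x‖ * ‖cutoffError ψ (n + 1) x‖
          ≤ |φ x| * (B * (wt x * (n + 1 : ℝ)⁻¹)) := by
            gcongr
            · exact le_rfl
            · exact hB _ (by linarith [Nat.cast_nonneg (α := ℝ) n]) x hx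
        _ = _ := by ring
    · rw [Set.indicator_of_notMem hx, cutoffError_eq_zero ψ (by positivity) hx]
      simp
  have iA : ∀ n : ℕ, Integrable ((annulus (n + 1)).indicator
      fun x => B * (|φ x * wt x| * (n + 1 : ℝ)⁻¹)) := by
    intro n
    rw [integrable_indicator_iff (measurableSet_annulus _)]
    have : IsFiniteMeasure ((volume : Measure Plane).restrict (annulus (n + 1))) :=
      ⟨by simpa using (measure_annulus_ne_top _).lt_top⟩
    exact (((hφ.mul_wt.restrict _).integrable (by norm_num)).abs.mul_const _).const_mul _
  have hcc : ∀ n : ℕ, Continuous (cutoffError ψ (n + 1)) := by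
    intro n
    have hc2 : ContDiff ℝ 2 fun x : Plane => cutoff ((n + 1 : ℝ)⁻¹ • x) := contDiff_cutoff_smul _
    refine (hψ.continuous.mul (continuous_laplacian hc2)).add
      (continuous_const.mul (continuous_finsetSum _ fun j _ => ?_))
    exact (hψ2.pd (m := 1) (by norm_num) j).continuous.mul
      (hc2.pd (m := 1) (by norm_num) j).continuous
  have iE : ∀ n : ℕ, Integrable fun x => φ x * cutoffError ψ (n + 1) x := fun n =>
    (iA n).mono' (hφm.mul (hcc n).aestronglyMeasurable) (Eventually.of_forall (hdom n))
  -- The error pairs $\varphi\,\mathrm{wt}\in L^2$ with $R^{-1}$ on the annulus, so it vanishes in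
  -- the limit without any pointwise decay of $\varphi$.
  have tE : Tendsto (fun n : ℕ => ∫ x, φ x * cutoffError ψ (n + 1) x) atTop (𝓝 0) := by
    refine squeeze_zero_norm (fun n => ?_)
      (by simpa only [mul_zero] using (tendsto_setIntegral_annulus hφ.mul_wt).const_mul B)
    refine (norm_integral_le_of_norm_le (iA n) (Eventually.of_forall (hdom n))).trans ?_
    rw [integral_indicator (measurableSet_annulus _), integral_const_mul]
  have heq : ∀ n : ℕ, -((∫ x, φ x * (Δ ψ) x * χ n x) + ∫ x, φ x * cutoffError ψ (n + 1) x) =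
      ∫ x, f x * ψ x * χ n x := by
    intro n
    have hχ : ContDiff ℝ ∞ (χ n) := contDiff_cutoff_smul _
    have htest : IsTestFunction fun x => ψ x * χ n x := by
      refine ⟨hψ.mul hχ, HasCompactSupport.mul_left ?_⟩
      exact cutoff.hasCompactSupport.comp_smul (by positivity)
    have h := hsol _ htest
    rw [← integral_add (i1.mul_bdd (c := 1) (hχc n).aestronglyMeasurable
      (Eventually.of_forall (hχ1 n))) (iE n)]
    simp only [mul_assoc]
    rw [← h]
    congr 1
    refine integral_congr_ae (Eventually.of_forall fun x => ?_)
    simp only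
    rw [laplacian_mul hψ2 (hχ.of_le ENat.LEInfty.out), cutoffError]
    ring
  have l1 := ((lim _ i1).add tE).neg
  have l2 := lim _ i2
  simp only [heq, add_zero] at l1
  exact tendsto_nhds_unique l1 l2

/-! ### Determinacy by moments -/

/-- Stereographic parametrization of the sphere, with values in `ℝ² × ℝ`. -/
def stereo (x : Plane) : Plane × ℝ := ((2 * wt x) • x, (1 - ‖x‖ ^ 2) * wt x)

lemma continuous_stereo : Continuous stereo := by
  have := continuous_wt
  unfold stereo
  fun_prop

lemma stereo_injective : Function.Injective stereo := by
  intro x y h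
  have h1 : (2 * wt x) • x = (2 * wt y) • y := congrArg Prod.fst h
  have h2 : (1 - ‖x‖ ^ 2) * wt x = (1 - ‖y‖ ^ 2) * wt y := congrArg Prod.snd h
  have h3 : wt x = wt y := by linarith [wt_mul x, wt_mul y]
  rw [h3] at h1
  exact smul_right_injective _ (by have := wt_pos y; positivity) h1

lemma sph_eq_inner_stereo (p : Plane) (q : ℝ) (x : Plane) :
    sph p q x = inner ℝ p (stereo x).1 + q * (stereo x).2 := by
  simp only [sph, stereo, inner_smul_right]
  ring

/-- Linear functions are bounded on the sphere, so the exponential series may be integrated term by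
term. -/
lemma integral_mul_cexp_eq_zero {f : Plane → ℝ} (hf : Integrable f) {p : Plane} {q : ℝ}
    (h : ∀ k : ℕ, ∫ x, f x * sph p q x ^ k = 0) :
    ∫ x, (f x : ℂ) * Complex.exp (sph p q x * Complex.I) = 0 := by
  set C := √(‖p‖ ^ 2 + q ^ 2) with hC
  have hC0 : 0 ≤ C := Real.sqrt_nonneg _
  have hb : ∀ x, |sph p q x| ≤ C := fun x => Real.abs_le_sqrt (sph_sq_le p q x)
  have hi : ∀ k : ℕ, Integrable fun x => f x * sph p q x ^ k := fun k =>
    hf.mul_bdd (c := C ^ k) ((continuous_sph p q).pow k).aestronglyMeasurable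
      (Filter.Eventually.of_forall fun x => by
        rw [norm_pow]; exact pow_le_pow_left₀ (norm_nonneg _) (hb x) k)
  let F : ℕ → Plane → ℂ := fun k x =>
    (Complex.I ^ k / k.factorial) * ((f x * sph p q x ^ k : ℝ) : ℂ)
  have hFi : ∀ k, Integrable (F k) := fun k => (hi k).ofReal.const_mul _
  have hFn : ∀ k x, ‖F k x‖ = |f x * sph p q x ^ k| / k.factorial := by
    intro k x
    simp only [F, norm_mul, norm_div, norm_pow, Complex.norm_I, one_pow, Complex.norm_natCast,
      Complex.norm_real, Real.norm_eq_abs]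
    rw [abs_mul, abs_pow]
    ring
  have hbd : ∀ k, ∫ x, ‖F k x‖ ≤ (C ^ k / k.factorial) * ∫ x, |f x| := by
    intro k
    rw [← integral_const_mul]
    refine integral_mono (hFi k).norm (hf.abs.const_mul _) fun x => ?_
    simp only [hFn, abs_mul, abs_pow]
    rw [div_mul_eq_mul_div, mul_comm]
    gcongr
    exact hb x
  have hs := hasSum_integral_of_summable_integral_norm hFi
    (Summable.of_nonneg_of_le (fun k => integral_nonneg fun x => norm_nonneg _) hbd
      ((Real.summable_pow_div_factorial C).mul_right _))
  have hz : ∀ k, ∫ x, F k x = 0 := by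
    intro k
    simp only [F]
    rw [integral_const_mul, integral_complex_ofReal, h k]
    simp
  simp only [hz] at hs
  have he : ∀ x, ∑' k, F k x = (f x : ℂ) * Complex.exp (sph p q x * Complex.I) := by
    intro x
    rw [Complex.exp_eq_exp_ℂ, NormedSpace.exp_eq_tsum_div, ← tsum_mul_left]
    refine tsum_congr fun k => ?_
    simp only [F]
    push_cast
    ring
  simp only [he] at hs
  exact hs.unique hasSum_zero

lemma integral_withDensity_ofReal {f : Plane → ℝ} (hf : Integrable f) (g : Plane → ℂ) :
    ∫ x, g x ∂(volume.withDensity fun x => ENNReal.ofReal (f x)) =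
      ∫ x, ((max (f x) 0 : ℝ) : ℂ) * g x := by
  rw [integral_withDensity_eq_integral_toReal_smul₀ hf.aemeasurable.ennreal_ofReal
    (Filter.Eventually.of_forall fun x => ENNReal.ofReal_lt_top)]
  simp [ENNReal.toReal_ofReal', Complex.real_smul]

/-- An integrable function on the sphere all of whose moments along lines vanish is zero. -/
theorem ae_eq_zero_of_moments {f : Plane → ℝ} (hf : Integrable f)
    (h : ∀ (p : Plane) (q : ℝ) (k : ℕ), ∫ x, f x * sph p q x ^ k = 0) : f =ᵐ[volume] 0 := by
  have hemb : MeasurableEmbedding stereo := continuous_stereo.measurableEmbedding stereo_injective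
  have hfn : Integrable fun x => -f x := hf.neg
  set μ₁ := volume.withDensity fun x => ENNReal.ofReal (f x) with hμ₁
  set μ₂ := volume.withDensity fun x => ENNReal.ofReal (-f x) with hμ₂
  have : IsFiniteMeasure μ₁ := isFiniteMeasure_withDensity_ofReal hf.2
  have : IsFiniteMeasure μ₂ := isFiniteMeasure_withDensity_ofReal hfn.2
  -- The positive and negative parts of $f$ become finite measures on $\mathbb R^2\times\mathbb R$.
  -- A functional $L$ pulls back to some `sph p q`, so the vanishing moments equate their
  -- characteristic functions.
  have hchar : charFunDual (μ₁.map stereo) = charFunDual (μ₂.map stereo) := by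
    ext L
    rw [charFunDual_apply, charFunDual_apply, hemb.integral_map, hemb.integral_map]
    let p : Plane := (InnerProductSpace.toDual ℝ Plane).symm
      (L.comp (ContinuousLinearMap.inl ℝ Plane ℝ))
    let q : ℝ := L (0, 1)
    have hL : ∀ x, L (stereo x) = sph p q x := by
      intro x
      have e1 : inner ℝ p (stereo x).1 = L ((stereo x).1, 0) := by
        simp [p, InnerProductSpace.toDual_symm_apply]
      have e2 : q * (stereo x).2 = L (0, (stereo x).2) := by
        rw [mul_comm, ← smul_eq_mul, ← map_smul]; simp
      rw [sph_eq_inner_stereo, e1, e2, ← map_add]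
      simp
    simp only [hL]
    rw [hμ₁, hμ₂, integral_withDensity_ofReal hf, integral_withDensity_ofReal hfn,
      ← sub_eq_zero]
    have hcm : AEStronglyMeasurable (fun x => Complex.exp (sph p q x * Complex.I)) volume := by
      have := continuous_sph p q
      exact (by fun_prop : Continuous fun x =>
        Complex.exp (sph p q x * Complex.I)).aestronglyMeasurable
    have hb : ∀ᵐ x : Plane, ‖Complex.exp (sph p q x * Complex.I)‖ ≤ 1 :=
      Filter.Eventually.of_forall fun x => (Complex.norm_exp_ofReal_mul_I _).le
    have hint : ∀ g : Plane → ℝ, Integrable g → Integrable fun x =>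
        ((max (g x) 0 : ℝ) : ℂ) * Complex.exp (sph p q x * Complex.I) := fun g hg =>
      hg.pos_part.ofReal.mul_bdd hcm hb
    rw [← integral_sub (hint _ hf) (hint _ hfn),
      ← integral_mul_cexp_eq_zero hf (h p q)]
    refine integral_congr_ae (Filter.Eventually.of_forall fun x => ?_)
    simp only
    rw [← sub_mul, ← Complex.ofReal_sub]
    congr 2
    rcases le_total (f x) 0 with h0 | h0
    · rw [max_eq_right h0, max_eq_left (by linarith)]; ring
    · rw [max_eq_left h0, max_eq_right (by linarith)]; ring
  have hmap := Measure.ext_of_charFunDual hchar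
  have heq : μ₁ = μ₂ := by
    rw [← hemb.comap_map μ₁, hmap, hemb.comap_map]
  have hae := (withDensity_eq_iff_of_sigmaFinite hf.aemeasurable.ennreal_ofReal
    hfn.aemeasurable.ennreal_ofReal).1 heq
  filter_upwards [hae] with x hx
  have h1 := congrArg ENNReal.toReal hx
  rw [ENNReal.toReal_ofReal', ENNReal.toReal_ofReal'] at h1
  simp only [Pi.zero_apply]
  rcases le_total (f x) 0 with h0 | h0
  · rw [max_eq_right h0, max_eq_left (by linarith)] at h1; linarith
  · rw [max_eq_left h0, max_eq_right (by linarith)] at h1; linarith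

/-! ### Moment identities and the vanishing of all moments -/

lemma abs_pd_sph_le {p : Plane} {q : ℝ} (h : ‖p‖ ^ 2 + q ^ 2 = 1) (x : Plane) (j : Fin 2) :
    |pd j (sph p q) x| ≤ 2 * wt x := by
  have h1 := sum_pd_sph_sq p q x
  have h2 := Finset.single_le_sum (f := fun j => pd j (sph p q) x ^ 2)
    (fun j _ => sq_nonneg _) (Finset.mem_univ j)
  have hw := wt_pos x
  refine abs_le_of_sq_le_sq (h2.trans ?_) (by positivity)
  rw [h1, h]
  nlinarith [mul_nonneg (sq_nonneg (wt x)) (sq_nonneg (sph p q x))]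

lemma abs_sph_pow_le {p : Plane} {q : ℝ} (h : ‖p‖ ^ 2 + q ^ 2 = 1) (k : ℕ) (x : Plane) :
    |sph p q x ^ k| ≤ 1 := by
  rw [abs_pow]; exact pow_le_one₀ (abs_nonneg _) (abs_sph_le_one h x)

lemma integrable_mul_sph_pow {p : Plane} {q : ℝ} (h : ‖p‖ ^ 2 + q ^ 2 = 1) {f : Plane → ℝ}
    (hf : Integrable f) (k : ℕ) : Integrable fun x => f x * sph p q x ^ k :=
  hf.mul_bdd (c := 1) ((continuous_sph p q).pow k).aestronglyMeasurable
    (Filter.Eventually.of_forall fun x => abs_sph_pow_le h k x)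

lemma laplacian_sub_const {f : Plane → ℝ} (hf : ContDiff ℝ 2 f) (c : ℝ) (x : Plane) :
    (Δ fun x => f x - c) x = (Δ f) x := by
  rw [laplacian_eq_sum_pd (hf.sub contDiff_const), laplacian_eq_sum_pd hf]
  simp only [pd_sub_const]

/-- The weak equation tested with powers of linear functions on the sphere. -/
lemma weak_moment_identity {φ A : Plane → ℝ} {κ : ℝ} (hφ : MemL2w φ) (hA : Integrable A)
    (hsol : IsDistributionalSolution φ fun x => A x + κ * (φ x * wt x ^ 2))
    {p : Plane} {q : ℝ} (h : ‖p‖ ^ 2 + q ^ 2 = 1) (k : ℕ) :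
    4 * k * (k + 1) * (∫ x, φ x * wt x ^ 2 * sph p q x ^ k) -
      4 * k * (k - 1) * (∫ x, φ x * wt x ^ 2 * sph p q x ^ (k - 2)) =
    (∫ x, A x * sph p q x ^ k) + κ * (∫ x, φ x * wt x ^ 2 * sph p q x ^ k) -
      (-q) ^ k * ((∫ x, A x) + κ * ∫ x, φ x * wt x ^ 2) := by
  have hφi := hφ.integrable_mul_wt_sq
  have hfi : Integrable fun x => A x + κ * (φ x * wt x ^ 2) := hA.add (hφi.const_mul κ)
  have hu : ContDiff ℝ ∞ fun x => sph p q x ^ k := (contDiff_sph p q).pow k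
  have hu2 : ContDiff ℝ 2 fun x => sph p q x ^ k := (contDiff_sph p q).pow k
  have hq : |-q| ≤ 1 := by
    rw [← sq_le_one_iff_abs_le_one]; nlinarith [sq_nonneg ‖p‖]
  have hk : (0 : ℝ) ≤ k := k.cast_nonneg
  have hk1 : (k : ℝ) * |(k : ℝ) - 1| ≤ k * (k + 1) := by
    gcongr
    rw [abs_le]; constructor <;> linarith
  have hΔ : ∀ x, (Δ fun x => sph p q x ^ k - (-q) ^ k) x = wt x ^ 2 *
      (-4 * k * (k + 1) * sph p q x ^ k + 4 * k * (k - 1) * sph p q x ^ (k - 2)) := fun x => by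
    rw [laplacian_sub_const hu2, laplacian_sph_pow h]
  -- The constant $(-q)^k$ is the value of $u^k$ at infinity. In $M$, the term $2k$ bounds the
  -- values and the gradient, and $8k(k+1)$ the Laplacian.
  have key := IsDistributionalSolution.extend hφ hfi hsol (hu.sub contDiff_const)
    (ψ := fun x => sph p q x ^ k - (-q) ^ k) (M := 2 * k + 8 * (k * (k + 1))) (by positivity)
    (fun x => ?_) (fun x j => ?_) (fun x => ?_)
  · have e1 : ∫ x, φ x * (Δ fun x => sph p q x ^ k - (-q) ^ k) x =
        -4 * k * (k + 1) * (∫ x, φ x * wt x ^ 2 * sph p q x ^ k) +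
          4 * k * (k - 1) * (∫ x, φ x * wt x ^ 2 * sph p q x ^ (k - 2)) := by
      rw [← integral_const_mul, ← integral_const_mul, ← integral_add
        ((integrable_mul_sph_pow h hφi k).const_mul _)
        ((integrable_mul_sph_pow h hφi (k - 2)).const_mul _)]
      refine integral_congr_ae (Filter.Eventually.of_forall fun x => ?_)
      simp only [hΔ]
      ring
    have e2 : ∫ x, (A x + κ * (φ x * wt x ^ 2)) * (sph p q x ^ k - (-q) ^ k) =
        (∫ x, A x * sph p q x ^ k) + κ * (∫ x, φ x * wt x ^ 2 * sph p q x ^ k) -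
          (-q) ^ k * ((∫ x, A x) + κ * ∫ x, φ x * wt x ^ 2) := by
      rw [← integral_const_mul, ← integral_const_mul, ← integral_add hA (hφi.const_mul κ),
        ← integral_const_mul, ← integral_add (integrable_mul_sph_pow h hA k)
          ((integrable_mul_sph_pow h hφi k).const_mul κ),
        ← integral_sub ((integrable_mul_sph_pow h hA k).fun_add
          ((integrable_mul_sph_pow h hφi k).const_mul κ)) (hfi.const_mul _)]
      refine integral_congr_ae (Filter.Eventually.of_forall fun x => ?_)
      simp only
      ring
    rw [e1, e2] at key
    linarith
  · have h1 : |sph p q x ^ k - (-q) ^ k| ≤ |sph p q x + q| * k := by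
      have h2 := abs_pow_sub_pow_le (a := sph p q x) (b := -q) (n := k)
      rw [sub_neg_eq_add] at h2
      refine h2.trans (mul_le_of_le_one_right (by positivity) (pow_le_one₀ (by positivity) ?_))
      exact max_le (abs_sph_le_one h x) hq
    have h3 := sph_add_sq_le p q x
    have hw := (wt_pos x).le
    rw [h, mul_one] at h3
    calc (sph p q x ^ k - (-q) ^ k) ^ 2 = |sph p q x ^ k - (-q) ^ k| ^ 2 := (sq_abs _).symm
      _ ≤ (|sph p q x + q| * k) ^ 2 := by gcongr
      _ = (sph p q x + q) ^ 2 * k ^ 2 := by rw [mul_pow, sq_abs]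
      _ ≤ 4 * wt x * k ^ 2 := by gcongr
      _ = (2 * k) ^ 2 * wt x := by ring
      _ ≤ (2 * k + 8 * (k * (k + 1))) ^ 2 * wt x := by
        gcongr
        nlinarith
  · rw [pd_sub_const, pd_pow (differentiable_sph p q)]
    have hw := (wt_pos x).le
    rw [abs_mul, abs_mul, Nat.abs_cast]
    calc k * |sph p q x ^ (k - 1)| * |pd j (sph p q) x| ≤ k * 1 * (2 * wt x) := by
          gcongr
          · exact abs_sph_pow_le h _ x
          · exact abs_pd_sph_le h x j
      _ = 2 * k * wt x := by ring
      _ ≤ _ := by gcongr; nlinarith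
  · rw [hΔ, abs_mul, abs_of_nonneg (sq_nonneg (wt x)), mul_comm]
    gcongr
    have t1 : |-4 * k * (k + 1) * sph p q x ^ k| ≤ 4 * (k * (k + 1)) := by
      rw [abs_mul, show -4 * (k : ℝ) * (k + 1) = -(4 * (k * (k + 1))) by ring, abs_neg,
        abs_of_nonneg (by positivity)]
      exact mul_le_of_le_one_right (by positivity) (abs_sph_pow_le h k x)
    have t2 : |4 * k * (k - 1) * sph p q x ^ (k - 2)| ≤ 4 * (k * (k + 1)) := by
      rw [abs_mul, show 4 * (k : ℝ) * (k - 1) = 4 * (k * (k - 1)) by ring, abs_mul, abs_mul,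
        Nat.abs_cast, abs_of_pos (by norm_num : (0 : ℝ) < 4)]
      refine (mul_le_of_le_one_right (by positivity) (abs_sph_pow_le h _ x)).trans ?_
      gcongr
    refine (abs_add_le _ _).trans ?_
    linarith

/-- All moments of a solution orthogonal to the linear functions vanish. -/
lemma moments_eq_zero {α : ℝ} (hα₀ : 0 < α) (hα : α < 2) {φ A : Plane → ℝ} (hφ : MemL2w φ)
    (hA : Integrable A)
    (hsol : IsDistributionalSolution φ fun x => A x + 2 * (4 - α) * (φ x * wt x ^ 2))
    (hgen : ∀ (p : Plane) (q : ℝ), ‖p‖ ^ 2 + q ^ 2 = 1 → ∀ t : ℝ, |t| < 1 →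
      ∫ x, A x * (1 - t * sph p q x) ^ (-((4 - α) / 2)) =
        2 * (4 - α) * (1 - t ^ 2) ^ (-((2 - α) / 2)) *
          ∫ x, (φ x * wt x ^ 2) * (1 - t * sph p q x) ^ (-(α / 2)))
    (horth : ∀ (p : Plane) (q : ℝ), ‖p‖ ^ 2 + q ^ 2 = 1 → ∫ x, φ x * wt x ^ 2 * sph p q x = 0)
    {p : Plane} {q : ℝ} (h : ‖p‖ ^ 2 + q ^ 2 = 1) (k : ℕ) :
    ∫ x, φ x * wt x ^ 2 * sph p q x ^ k = 0 := by
  have hφi := hφ.integrable_mul_wt_sq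
  have hs : 0 < (4 - α) / 2 := by linarith
  have ser1 : ∀ (p : Plane) (q : ℝ), ‖p‖ ^ 2 + q ^ 2 = 1 → ∀ t : ℝ, |t| < 1 → _ :=
    fun p q h t ht => hasSum_integral_mul_rpow hA (continuous_sph p q).aestronglyMeasurable
      (abs_sph_le_one h) hs ht
  have ser2 : ∀ (p : Plane) (q : ℝ), ‖p‖ ^ 2 + q ^ 2 = 1 → ∀ t : ℝ, |t| < 1 → _ :=
    fun p q h t ht => hasSum_integral_mul_rpow hφi (continuous_sph p q).aestronglyMeasurable
      (abs_sph_le_one h) (half_pos hα₀) ht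
  have hg0 : (fun t : ℝ => (1 - t ^ 2) ^ (-((2 - α) / 2))) 0 = 1 := by simp
  have hg := hasDerivAt_one_sub_sq_rpow (-((2 - α) / 2))
  -- the mass: test with the vertical coordinate
  have hpole : ‖(0 : Plane)‖ ^ 2 + (1 : ℝ) ^ 2 = 1 := by simp
  have hm0 : ∫ x, φ x * wt x ^ 2 = 0 ∧ ∫ x, A x = 0 := by
    have c1 := first_coeff_eq (ser1 _ _ hpole) (ser2 _ _ hpole) (hgen _ _ hpole) hg0 hg
    have c0 := leading_coeff_eq (ser1 _ _ hpole) (ser2 _ _ hpole) (hgen _ _ hpole) hg0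
      hg.continuousAt (k := 0) (by simp) (by simp)
    have w := weak_moment_identity hφ hA hsol hpole 1
    simp only [binomCoeff_one, binomCoeff_zero, pow_one, pow_zero, mul_one, one_mul,
      horth _ _ hpole, mul_zero] at c1 c0 w
    have hn1 : ∫ x, A x * sph 0 1 x = 0 := by
      rcases mul_eq_zero.1 c1 with h0 | h0
      · linarith
      · exact h0
    rw [hn1] at w
    norm_num at w
    -- The value $-1$ of the vertical coordinate at infinity makes the total mass appear:
    -- $n_0+\kappa m_0=0$, while the zeroth coefficient gives $n_0=\kappa m_0$.
    have h4 : 4 * (4 - α) * ∫ x, φ x * wt x ^ 2 = 0 := by linarith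
    have hz : ∫ x, φ x * wt x ^ 2 = 0 := by
      rcases mul_eq_zero.1 h4 with h0 | h0
      · linarith
      · exact h0
    exact ⟨hz, by rw [c0, hz, mul_zero]⟩
  have weak : ∀ k : ℕ, 4 * k * (k + 1) * (∫ x, φ x * wt x ^ 2 * sph p q x ^ k) -
      4 * k * (k - 1) * (∫ x, φ x * wt x ^ 2 * sph p q x ^ (k - 2)) =
      (∫ x, A x * sph p q x ^ k) + 2 * (4 - α) * (∫ x, φ x * wt x ^ 2 * sph p q x ^ k) := by
    intro k
    have := weak_moment_identity hφ hA hsol h k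
    rw [hm0.1, hm0.2] at this
    simpa using this
  induction k using Nat.strong_induction_on with
  | _ k ih =>
    -- The induction is on $m_k$ alone; the weak identity transfers vanishing to $n_j$. For $j<2$
    -- the truncated $j-2$ is harmless.
    have hnj : ∀ j < k, ∫ x, A x * sph p q x ^ j = 0 := by
      intro j hj
      have w := weak j
      rw [ih j hj, ih (j - 2) (by omega)] at w
      linarith
    have lead := leading_coeff_eq (ser1 _ _ h) (ser2 _ _ h) (hgen _ _ h) hg0 hg.continuousAt
      (k := k) (fun j hj => by rw [hnj j hj, mul_zero]) (fun j hj => by rw [ih j hj, mul_zero])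
    rcases k with _ | _ | k
    · simpa using hm0.1
    · simpa using horth p q h
    · have w := weak (k + 2)
      rw [ih (k + 2 - 2) (by omega)] at w
      set m := ∫ x, φ x * wt x ^ 2 * sph p q x ^ (k + 2)
      set n := ∫ x, A x * sph p q x ^ (k + 2)
      have hb := binomCoeff_pos hs (k + 2)
      have hb' := binomCoeff_le (half_pos hα₀) (by linarith : α / 2 ≤ (4 - α) / 2) (k + 2)
      set b := binomCoeff ((4 - α) / 2) (k + 2)
      set b' := binomCoeff (α / 2) (k + 2)
      -- Elimination of $n$ between the weak identity and the leading coefficients. The factor is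
      -- positive because $b'\le b$ and $24>4(4-\alpha)$.
      have hz : ((4 * (k + 2) * (k + 3) - 2 * (4 - α)) * b - 2 * (4 - α) * b') * m = 0 := by
        push_cast at w
        linear_combination b * w + lead
      refine (mul_eq_zero.1 hz).resolve_left (ne_of_gt ?_)
      have hk : (0 : ℝ) ≤ k := k.cast_nonneg
      have : 2 * (4 - α) * b' ≤ 2 * (4 - α) * b := by
        have : 0 < 4 - α := by linarith
        gcongr
      have h24 : (24 : ℝ) ≤ 4 * (k + 2) * (k + 3) := by nlinarith
      nlinarith

/-! ### Weighted inner products of linear functions -/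

/-- Rotation of the plane by a right angle. -/
def quarterTurn : Plane ≃ₗᵢ[ℝ] Plane where
  toFun x := !₂[-x 1, x 0]
  invFun x := !₂[x 1, -x 0]
  map_add' x y := by ext j; fin_cases j <;> simp; ring
  map_smul' c x := by ext j; fin_cases j <;> simp
  left_inv x := by ext j; fin_cases j <;> simp
  right_inv x := by ext j; fin_cases j <;> simp
  norm_map' x := by
    have h : ‖!₂[-x 1, x 0]‖ ^ 2 = ‖x‖ ^ 2 := by
      rw [normSq_eq, normSq_eq]; simp; ring
    exact (sq_eq_sq₀ (norm_nonneg _) (norm_nonneg _)).1 h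

lemma wt_quarterTurn (x : Plane) : wt (quarterTurn x) = wt x := by
  rw [wt, wt, LinearIsometryEquiv.norm_map]

lemma sph_quarterTurn (p : Plane) (q : ℝ) (x : Plane) :
    sph p q (quarterTurn x) = sph (quarterTurn.symm p) q x := by
  rw [sph, sph, wt_quarterTurn, LinearIsometryEquiv.norm_map,
    ← quarterTurn.inner_map_map (quarterTurn.symm p),
    LinearIsometryEquiv.apply_symm_apply]

lemma integral_comp_quarterTurn (f : Plane → ℝ) : ∫ x, f (quarterTurn x) = ∫ x, f x :=
  quarterTurn.measurePreserving.integral_comp quarterTurn.toHomeomorph.measurableEmbedding f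

lemma sph_smul (c : ℝ) (p : Plane) (q : ℝ) (x : Plane) :
    sph (c • p) (c * q) x = c * sph p q x := by
  simp only [sph, real_inner_smul_left]; ring

lemma sph_stdVec (j : Fin 2) (x : Plane) : sph (stdVec j) 0 x = 2 * x j * wt x := by
  rw [sph, real_inner_comm, inner_stdVec]; ring

lemma sph_eq_coord (p : Plane) (q : ℝ) (x : Plane) :
    sph p q x = p 0 * sph (stdVec 0) 0 x + p 1 * sph (stdVec 1) 0 x + q * sph 0 1 x := by
  simp only [sph_stdVec]
  simp only [sph, inner_zero_left, inner_eq]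
  ring

lemma quarterTurn_symm_stdVec_zero : quarterTurn.symm (stdVec 0) = -stdVec 1 := by
  rw [LinearIsometryEquiv.symm_apply_eq]
  ext j; fin_cases j <;> simp [quarterTurn, stdVec]

lemma quarterTurn_symm_stdVec_one : quarterTurn.symm (stdVec 1) = stdVec 0 := by
  rw [LinearIsometryEquiv.symm_apply_eq]
  ext j; fin_cases j <;> simp [quarterTurn, stdVec]

lemma sph_neg_stdVec (j : Fin 2) (x : Plane) : sph (-stdVec j) 0 x = -sph (stdVec j) 0 x := by
  simp [sph]

lemma integrable_wt_sq_mul_bdd {g : Plane → ℝ} (hg : Continuous g) {C : ℝ}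
    (hC : ∀ x, |g x| ≤ C) : Integrable fun x => wt x ^ 2 * g x :=
  integrable_wt_sq.mul_bdd (c := C) hg.aestronglyMeasurable (Filter.Eventually.of_forall hC)

lemma abs_sph_le (p : Plane) (q : ℝ) (x : Plane) : |sph p q x| ≤ √(‖p‖ ^ 2 + q ^ 2) :=
  Real.abs_le_sqrt (sph_sq_le p q x)

lemma integrable_wt_sq_mul_sph (p : Plane) (q : ℝ) : Integrable fun x => wt x ^ 2 * sph p q x :=
  integrable_wt_sq_mul_bdd (continuous_sph p q) (abs_sph_le p q)

lemma integrable_wt_sq_mul_sph_mul_sph (p p' : Plane) (q q' : ℝ) :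
    Integrable fun x => wt x ^ 2 * (sph p q x * sph p' q' x) :=
  integrable_wt_sq_mul_bdd ((continuous_sph p q).mul (continuous_sph p' q')) fun x => by
    rw [abs_mul]
    exact mul_le_mul (abs_sph_le p q x) (abs_sph_le p' q' x) (abs_nonneg _) (Real.sqrt_nonneg _)

lemma integral_wt_pow (n : ℕ) (hn : 1 < n) :
    Integrable (fun x : Plane => wt x ^ n) ∧ ∫ x : Plane, wt x ^ n = Real.pi / (n - 1) := by
  have h : (1 : ℝ) < n := by exact_mod_cast hn
  have h1 := integrable_wt_rpow h
  have h2 := integral_wt_rpow h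
  simp only [Real.rpow_natCast] at h1 h2
  exact ⟨h1, h2⟩

lemma sph_pole (x : Plane) : sph 0 1 x = 2 * wt x - 1 := by
  rw [sph_eq]; simp

lemma integral_wt_sq_mul_pole : ∫ x, wt x ^ 2 * sph 0 1 x = 0 := by
  obtain ⟨i2, e2⟩ := integral_wt_pow 2 (by norm_num)
  obtain ⟨i3, e3⟩ := integral_wt_pow 3 (by norm_num)
  have : (fun x => wt x ^ 2 * sph 0 1 x) = fun x => 2 * wt x ^ 3 - wt x ^ 2 := by
    ext x; rw [sph_pole]; ring
  rw [this, integral_sub (i3.const_mul 2) i2, integral_const_mul, e2, e3]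
  push_cast
  ring

lemma integral_wt_sq_mul_pole_sq : ∫ x, wt x ^ 2 * (sph 0 1 x * sph 0 1 x) = Real.pi / 3 := by
  obtain ⟨i2, e2⟩ := integral_wt_pow 2 (by norm_num)
  obtain ⟨i3, e3⟩ := integral_wt_pow 3 (by norm_num)
  obtain ⟨i4, e4⟩ := integral_wt_pow 4 (by norm_num)
  have : (fun x => wt x ^ 2 * (sph 0 1 x * sph 0 1 x)) =
      fun x => 4 * wt x ^ 4 + -4 * wt x ^ 3 + wt x ^ 2 := by
    ext x; rw [sph_pole]; ring
  rw [this, integral_add ((i4.const_mul 4).fun_add (i3.const_mul (-4))) i2,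
    integral_add (i4.const_mul 4) (i3.const_mul (-4)), integral_const_mul, integral_const_mul,
    e2, e3, e4]
  push_cast
  ring

/-- A quarter turn sends the two horizontal coordinates to each other with one sign change, which
kills their means; the vertical one is an explicit radial integral. -/
lemma integral_wt_sq_mul_sph (p : Plane) (q : ℝ) : ∫ x, wt x ^ 2 * sph p q x = 0 := by
  have h0 := integral_comp_quarterTurn fun x => wt x ^ 2 * sph (stdVec 0) 0 x
  have h1 := integral_comp_quarterTurn fun x => wt x ^ 2 * sph (stdVec 1) 0 x
  simp only [wt_quarterTurn, sph_quarterTurn, quarterTurn_symm_stdVec_zero,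
    quarterTurn_symm_stdVec_one, sph_neg_stdVec, mul_neg, integral_neg] at h0 h1
  have e : (fun x => wt x ^ 2 * sph p q x) = fun x => p 0 * (wt x ^ 2 * sph (stdVec 0) 0 x) +
      p 1 * (wt x ^ 2 * sph (stdVec 1) 0 x) + q * (wt x ^ 2 * sph 0 1 x) := by
    ext x; rw [sph_eq_coord]; ring
  have i := integrable_wt_sq_mul_sph
  rw [e, integral_add (((i _ _).const_mul _).fun_add ((i _ _).const_mul _)) ((i _ _).const_mul _),
    integral_add ((i _ _).const_mul _) ((i _ _).const_mul _), integral_const_mul,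
    integral_const_mul, integral_const_mul, integral_wt_sq_mul_pole]
  rw [show ∫ x, wt x ^ 2 * sph (stdVec 0) 0 x = 0 by linarith,
    show ∫ x, wt x ^ 2 * sph (stdVec 1) 0 x = 0 by linarith]
  ring

/-- The linear functions on the sphere are orthogonal in the weighted space. -/
lemma integral_wt_sq_mul_sph_mul_sph (p p' : Plane) (q q' : ℝ) :
    ∫ x, wt x ^ 2 * (sph p q x * sph p' q' x) = Real.pi / 3 * (inner ℝ p p' + q * q') := by
  have h00 := integral_comp_quarterTurn fun x =>
    wt x ^ 2 * (sph (stdVec 0) 0 x * sph (stdVec 0) 0 x)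
  have h01 := integral_comp_quarterTurn fun x =>
    wt x ^ 2 * (sph (stdVec 0) 0 x * sph (stdVec 1) 0 x)
  have h02 := integral_comp_quarterTurn fun x => wt x ^ 2 * (sph (stdVec 0) 0 x * sph 0 1 x)
  have h12 := integral_comp_quarterTurn fun x => wt x ^ 2 * (sph (stdVec 1) 0 x * sph 0 1 x)
  have h22 := integral_wt_sq_mul_pole_sq
  simp only [wt_quarterTurn, sph_quarterTurn, quarterTurn_symm_stdVec_zero,
    quarterTurn_symm_stdVec_one, sph_neg_stdVec, map_zero, mul_neg, neg_mul, neg_neg,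
    integral_neg] at h00 h01 h02 h12
  have i := integrable_wt_sq_mul_sph_mul_sph
  -- The coordinates satisfy $\xi_1^2+\xi_2^2+\xi_3^2=1$. The vertical square contributes $\pi/3$
  -- and rotation equates the other two, so each is $\pi/3$.
  have hsum : (∫ x, wt x ^ 2 * (sph (stdVec 0) 0 x * sph (stdVec 0) 0 x)) +
      (∫ x, wt x ^ 2 * (sph (stdVec 1) 0 x * sph (stdVec 1) 0 x)) +
      (∫ x, wt x ^ 2 * (sph 0 1 x * sph 0 1 x)) = Real.pi := by
    obtain ⟨-, e2⟩ := integral_wt_pow 2 (by norm_num)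
    rw [← integral_add (i _ _ _ _) (i _ _ _ _),
      ← integral_add ((i _ _ _ _).fun_add (i _ _ _ _)) (i _ _ _ _)]
    rw [show Real.pi = Real.pi / ((2 : ℕ) - 1 : ℝ) by push_cast; ring, ← e2]
    refine integral_congr_ae (Filter.Eventually.of_forall fun x => ?_)
    have h := wt_mul x
    rw [normSq_eq] at h
    simp only [sph_pole, sph_stdVec]
    linear_combination (4 * wt x ^ 3) * h
  have hswap : ∫ x, wt x ^ 2 * (sph (stdVec 1) 0 x * sph (stdVec 0) 0 x) =
      ∫ x, wt x ^ 2 * (sph (stdVec 0) 0 x * sph (stdVec 1) 0 x) := by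
    simp only [mul_comm (sph (stdVec 1) 0 _)]
  rw [hswap] at h01
  have e : (fun x => wt x ^ 2 * (sph p q x * sph p' q' x)) = fun x =>
      p 0 * p' 0 * (wt x ^ 2 * (sph (stdVec 0) 0 x * sph (stdVec 0) 0 x)) +
      p 1 * p' 1 * (wt x ^ 2 * (sph (stdVec 1) 0 x * sph (stdVec 1) 0 x)) +
      q * q' * (wt x ^ 2 * (sph 0 1 x * sph 0 1 x)) +
      (p 0 * p' 1 + p 1 * p' 0) * (wt x ^ 2 * (sph (stdVec 0) 0 x * sph (stdVec 1) 0 x)) +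
      (p 0 * q' + q * p' 0) * (wt x ^ 2 * (sph (stdVec 0) 0 x * sph 0 1 x)) +
      (p 1 * q' + q * p' 1) * (wt x ^ 2 * (sph (stdVec 1) 0 x * sph 0 1 x)) := by
    ext x; rw [sph_eq_coord p, sph_eq_coord p']; ring
  have j := fun (c : ℝ) (p p' : Plane) (q q' : ℝ) => (i p p' q q').const_mul c
  rw [e, integral_add (((((j _ _ _ _ _).fun_add (j _ _ _ _ _)).fun_add (j _ _ _ _ _)).fun_add
      (j _ _ _ _ _)).fun_add (j _ _ _ _ _)) (j _ _ _ _ _),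
    integral_add ((((j _ _ _ _ _).fun_add (j _ _ _ _ _)).fun_add (j _ _ _ _ _)).fun_add
      (j _ _ _ _ _)) (j _ _ _ _ _),
    integral_add (((j _ _ _ _ _).fun_add (j _ _ _ _ _)).fun_add (j _ _ _ _ _)) (j _ _ _ _ _),
    integral_add ((j _ _ _ _ _).fun_add (j _ _ _ _ _)) (j _ _ _ _ _),
    integral_add (j _ _ _ _ _) (j _ _ _ _ _)]
  simp only [integral_const_mul]
  have z01 : ∫ x, wt x ^ 2 * (sph (stdVec 0) 0 x * sph (stdVec 1) 0 x) = 0 := by linarith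
  have z02 : ∫ x, wt x ^ 2 * (sph (stdVec 0) 0 x * sph 0 1 x) = 0 := by linarith
  have z12 : ∫ x, wt x ^ 2 * (sph (stdVec 1) 0 x * sph 0 1 x) = 0 := by linarith
  have z00 : ∫ x, wt x ^ 2 * (sph (stdVec 0) 0 x * sph (stdVec 0) 0 x) = Real.pi / 3 := by linarith
  have z11 : ∫ x, wt x ^ 2 * (sph (stdVec 1) 0 x * sph (stdVec 1) 0 x) = Real.pi / 3 := by linarith
  rw [z01, z02, z12, z00, z11, h22, inner_eq]
  ring

/-! ### Removing the linear part and classifying the solutions -/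

lemma memL2w_sph (p : Plane) (q : ℝ) : MemL2w (sph p q) := by
  have h1 : Continuous fun x => sph p q x * wt x := (continuous_sph p q).mul continuous_wt
  have h : MemLp (fun x => sph p q x * wt x) 2 volume := by
    refine (memLp_two_iff_integrable_sq h1.aestronglyMeasurable).2 ?_
    refine (integrable_wt_sq_mul_sph_mul_sph p p q q).congr
      (Filter.Eventually.of_forall fun x => ?_)
    simp only
    ring
  simpa [MemL2w, div_eq_mul_inv, wt] using h

lemma MemL2w.sub {φ v : Plane → ℝ} (hφ : MemL2w φ) (hv : MemL2w v) :
    MemL2w fun x => φ x - v x := by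
  have h := MemLp.sub hφ hv
  refine (memLp_congr_ae (Filter.Eventually.of_forall fun x => ?_)).1 h
  simp only [Pi.sub_apply]
  ring

lemma MemL2w.locallyIntegrable {φ : Plane → ℝ} (hφ : MemL2w φ) : LocallyIntegrable φ volume := by
  have h1 : Continuous fun x : Plane => (1 + ‖x‖ ^ 2) ^ 2 := by fun_prop
  have h := hφ.integrable_mul_wt_sq.locallyIntegrable.mul_continuous h1
  have e : (fun x => φ x * wt x ^ 2 * (1 + ‖x‖ ^ 2) ^ 2) = φ := by
    ext x
    rw [mul_assoc, ← mul_pow, wt_mul, one_pow, mul_one]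
  rwa [e] at h

lemma integral_mul_pd {f g : Plane → ℝ} (hf : ContDiff ℝ 1 f) (hg : ContDiff ℝ 1 g)
    (hc : HasCompactSupport g) (j : Fin 2) :
    ∫ x, f x * pd j g x = -∫ x, pd j f x * g x := by
  have hg' : HasCompactSupport (pd j g) := hc.fderiv_apply (𝕜 := ℝ) (stdVec j)
  have cf := (hf.pd (m := 0) (by norm_num) j).continuous
  have cg := (hg.pd (m := 0) (by norm_num) j).continuous
  exact integral_mul_fderiv_eq_neg_fderiv_mul_of_integrable
    ((cf.mul hg.continuous).integrable_of_hasCompactSupport hc.mul_left)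
    ((hf.continuous.mul cg).integrable_of_hasCompactSupport hg'.mul_left)
    ((hf.continuous.mul hg.continuous).integrable_of_hasCompactSupport hc.mul_left)
    (fun x _ => hf.differentiable (by norm_num) x) (fun x _ => hg.differentiable (by norm_num) x)

lemma hasCompactSupport_laplacian {g : Plane → ℝ} (hc : HasCompactSupport g) : HasCompactSupport (Δ g) := by
  refine hc.mono' fun x hx => ?_
  by_contra h
  exact hx (laplacian_eq_zero_of_eventuallyEq_const (notMem_tsupport_iff_eventuallyEq.1 h))

/-- Green's formula against a compactly supported function. -/
lemma integral_mul_laplacian {f g : Plane → ℝ} (hf : ContDiff ℝ 2 f) (hg : ContDiff ℝ 2 g)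
    (hc : HasCompactSupport g) : ∫ x, f x * (Δ g) x = ∫ x, (Δ f) x * g x := by
  have hg' : ∀ j, HasCompactSupport (pd j g) := fun j => hc.fderiv_apply (𝕜 := ℝ) (stdVec j)
  have hg'' : ∀ j, HasCompactSupport (pd j (pd j g)) := fun j =>
    (hg' j).fderiv_apply (𝕜 := ℝ) (stdVec j)
  have f1 := fun j => hf.pd (m := 1) (by norm_num) j
  have g1 := fun j => hg.pd (m := 1) (by norm_num) j
  have f2 := fun j => ((f1 j).pd (m := 0) (by norm_num) j).continuous
  have g2 := fun j => ((g1 j).pd (m := 0) (by norm_num) j).continuous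
  have hf1 : ContDiff ℝ 1 f := hf.of_le (by norm_num)
  have hg1 : ContDiff ℝ 1 g := hg.of_le (by norm_num)
  simp only [laplacian_eq_sum_pd hf, laplacian_eq_sum_pd hg, Finset.mul_sum, Finset.sum_mul]
  have i1 : ∀ j, Integrable fun x => f x * pd j (pd j g) x := fun j =>
    (hf.continuous.mul (g2 j)).integrable_of_hasCompactSupport (hg'' j).mul_left
  have i2 : ∀ j, Integrable fun x => pd j (pd j f) x * g x := fun j =>
    ((f2 j).mul hg.continuous).integrable_of_hasCompactSupport hc.mul_left
  rw [integral_finsetSum _ fun j _ => i1 j, integral_finsetSum _ fun j _ => i2 j]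
  refine Finset.sum_congr rfl fun j _ => ?_
  rw [integral_mul_pd hf1 (g1 j) (hg' j), integral_mul_pd (f1 j) hg1 hc, neg_neg]

lemma rieszTerm_const_mul (α c : ℝ) (f : Plane → ℝ) (x : Plane) :
    rieszTerm α (fun y => c * f y) x = c * rieszTerm α f x := by
  have e : (fun y => Real.exp (bubble α y) * (c * f y) / ‖x - y‖ ^ α) =
      fun y => c * (Real.exp (bubble α y) * f y / ‖x - y‖ ^ α) := by
    ext y; ring
  rw [rieszTerm, rieszTerm, e, integral_const_mul]
  ring

/-- Homogeneity reduces everything to unit vectors; for the zero vector, $c=0$ with an arbitrary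
one. -/
lemma exists_unit_sph (p : Plane) (q : ℝ) : ∃ (c : ℝ) (p' : Plane) (q' : ℝ),
    ‖p'‖ ^ 2 + q' ^ 2 = 1 ∧ ∀ x, sph p q x = c * sph p' q' x := by
  rcases eq_or_ne (‖p‖ ^ 2 + q ^ 2) 0 with h | h
  · have hp : p = 0 := norm_eq_zero.1 (by nlinarith [sq_nonneg ‖p‖, sq_nonneg q])
    have hq : q = 0 := by nlinarith [sq_nonneg ‖p‖, sq_nonneg q]
    exact ⟨0, 0, 1, by simp, fun x => by simp [hp, hq, sph]⟩
  · have hpos : 0 < ‖p‖ ^ 2 + q ^ 2 := lt_of_le_of_ne (by positivity) h.symm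
    set c := √(‖p‖ ^ 2 + q ^ 2) with hc
    have hc0 : 0 < c := Real.sqrt_pos.2 hpos
    have hc2 : c ^ 2 = ‖p‖ ^ 2 + q ^ 2 := Real.sq_sqrt hpos.le
    refine ⟨c, c⁻¹ • p, c⁻¹ * q, ?_, fun x => ?_⟩
    · rw [norm_smul, mul_pow, mul_pow, Real.norm_of_nonneg (by positivity), ← mul_add, ← hc2]
      field_simp
    · rw [sph_smul]
      field_simp

lemma rieszTerm_sph {α : ℝ} (hα : α < 2) (p : Plane) (q : ℝ) (x : Plane) :
    rieszTerm α (sph p q) x = 2 * α * (wt x ^ 2 * sph p q x) := by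
  obtain ⟨c, p', q', h, e⟩ := exists_unit_sph p q
  rw [funext e, rieszTerm_const_mul, rieszTerm_sph_of_unit hα h]
  ring

lemma integrable_mul_rpow_sph {f : Plane → ℝ} (hf : Integrable f) {p : Plane} {q : ℝ}
    (h : ‖p‖ ^ 2 + q ^ 2 = 1) {t : ℝ} (ht : |t| < 1) {σ : ℝ} (hσ : 0 < σ) :
    Integrable fun x => f x * (1 - t * sph p q x) ^ (-σ) := by
  have hc : Continuous fun x => (1 - t * sph p q x) ^ (-σ) :=
    (continuous_const.sub (continuous_const.mul (continuous_sph p q))).rpow_const fun x =>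
      Or.inl ((one_sub_mul_sph_pos h ht x).1.trans_le (one_sub_mul_sph_pos h ht x).2).ne'
  refine hf.mul_bdd (c := (1 - |t|) ^ (-σ)) hc.aestronglyMeasurable
    (Filter.Eventually.of_forall fun x => ?_)
  obtain ⟨h1, h2⟩ := one_sub_mul_sph_pos h ht x
  rw [Real.norm_of_nonneg (Real.rpow_nonneg (h1.le.trans h2) _)]
  exact Real.rpow_le_rpow_of_nonpos h1 h2 (by linarith)

lemma integrable_linearizedRHS {α : ℝ} (hα : α < 2) {φ : Plane → ℝ} (hφ : MemL2w φ) :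
    Integrable (linearizedRHS α φ) := by
  rw [funext (linearizedRHS_eq hα φ)]
  exact (integrable_rieszTerm hα hφ.integrable_mul_wt_sq).add
    (hφ.integrable_mul_wt_sq.const_mul _)

/-- Subtracting a linear function on the sphere preserves the weak linearized equation. -/
lemma IsDistributionalSolution.sub_sph {α : ℝ} (hα : α < 2) {φ : Plane → ℝ} (hφ : MemL2w φ)
    (hsol : IsDistributionalSolution φ (linearizedRHS α φ)) (p : Plane) (q : ℝ) :
    IsDistributionalSolution (fun x => φ x - sph p q x) fun x =>
      (rieszTerm α φ x - rieszTerm α (sph p q) x) +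
        2 * (4 - α) * ((φ x - sph p q x) * wt x ^ 2) := by
  intro ψ hψ
  have hψ2 : ContDiff ℝ 2 ψ := hψ.1.of_le ENat.LEInfty.out
  have hv2 : ContDiff ℝ 2 (sph p q) := contDiff_sph p q
  have hΔ := continuous_laplacian hψ2
  have hΔc := hasCompactSupport_laplacian hψ.2
  have i1 : Integrable fun x => φ x * (Δ ψ) x :=
    hφ.locallyIntegrable.integrable_smul_right_of_hasCompactSupport hΔ hΔc
  have i2 : Integrable fun x => sph p q x * (Δ ψ) x :=
    ((continuous_sph p q).mul hΔ).integrable_of_hasCompactSupport hΔc.mul_left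
  have i3 : Integrable fun x => linearizedRHS α φ x * ψ x :=
    (integrable_linearizedRHS hα hφ).locallyIntegrable.integrable_smul_right_of_hasCompactSupport
      hψ.1.continuous hψ.2
  have i4 : Integrable fun x => (Δ (sph p q)) x * ψ x :=
    ((continuous_laplacian hv2).mul hψ.1.continuous).integrable_of_hasCompactSupport
      hψ.2.mul_left
  simp only [sub_mul]
  rw [integral_sub i1 i2, integral_mul_laplacian hv2 hψ2 hψ.2, neg_sub, sub_eq_add_neg, hsol ψ hψ,
    ← integral_add i4 i3]
  refine integral_congr_ae (Filter.Eventually.of_forall fun x => ?_)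
  -- Linear functions solve the equation because $2\alpha+2(4-\alpha)=8$.
  simp only [linearizedRHS_eq hα, laplacian_sph, rieszTerm_sph hα]
  ring

/-- Solutions of the linearized equation are linear functions on the sphere. -/
theorem exists_ae_eq_sph {α : ℝ} (hα₀ : 0 < α) (hα : α < 2) {φ : Plane → ℝ} (hφ : MemL2w φ)
    (hsol : IsDistributionalSolution φ (linearizedRHS α φ)) :
    ∃ (p : Plane) (q : ℝ), φ =ᵐ[volume] sph p q := by
  have hφi := hφ.integrable_mul_wt_sq
  -- Coefficients of the orthogonal projection onto linear functions; $\pi/3$ is the squared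
  -- weighted norm of each coordinate.
  let P : Plane := !₂[3 / Real.pi * ∫ x, φ x * wt x ^ 2 * sph (stdVec 0) 0 x,
    3 / Real.pi * ∫ x, φ x * wt x ^ 2 * sph (stdVec 1) 0 x]
  let Q : ℝ := 3 / Real.pi * ∫ x, φ x * wt x ^ 2 * sph 0 1 x
  have hv : MemL2w (sph P Q) := memL2w_sph P Q
  have hvi := hv.integrable_mul_wt_sq
  have hφ' := hφ.sub hv
  have hA := integrable_rieszTerm hα hφi
  have hAv := integrable_rieszTerm hα hvi
  have hmul : ∀ (p : Plane) (q : ℝ), Integrable fun x => φ x * wt x ^ 2 * sph p q x := fun p q =>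
    hφi.mul_bdd (c := √(‖p‖ ^ 2 + q ^ 2)) (continuous_sph p q).aestronglyMeasurable
      (Filter.Eventually.of_forall (abs_sph_le p q))
  have horth : ∀ (p : Plane) (q : ℝ), ∫ x, (φ x - sph P Q x) * wt x ^ 2 * sph p q x = 0 := by
    intro p q
    have e1 : ∫ x, φ x * wt x ^ 2 * sph p q x = Real.pi / 3 * (inner ℝ P p + Q * q) := by
      have e : (fun x => φ x * wt x ^ 2 * sph p q x) = fun x =>
          p 0 * (φ x * wt x ^ 2 * sph (stdVec 0) 0 x) +
          p 1 * (φ x * wt x ^ 2 * sph (stdVec 1) 0 x) + q * (φ x * wt x ^ 2 * sph 0 1 x) := by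
        ext x; rw [sph_eq_coord p q]; ring
      rw [e, integral_add (((hmul _ _).const_mul _).fun_add ((hmul _ _).const_mul _))
        ((hmul _ _).const_mul _), integral_add ((hmul _ _).const_mul _) ((hmul _ _).const_mul _),
        integral_const_mul, integral_const_mul, integral_const_mul, inner_eq]
      have hpi := Real.pi_pos.ne'
      simp [P, Q]
      field_simp
    have e2 : (fun x => (φ x - sph P Q x) * wt x ^ 2 * sph p q x) = fun x =>
        φ x * wt x ^ 2 * sph p q x - wt x ^ 2 * (sph P Q x * sph p q x) := by
      ext x; ring
    rw [e2, integral_sub (hmul p q) (integrable_wt_sq_mul_sph_mul_sph _ _ _ _), e1,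
      integral_wt_sq_mul_sph_mul_sph, sub_self]
  -- The two generating identities are subtracted after integration, so additivity of `rieszTerm` at
  -- each point, where convergence for `φ` is not established, is never needed.
  have hgen : ∀ (p : Plane) (q : ℝ), ‖p‖ ^ 2 + q ^ 2 = 1 → ∀ t : ℝ, |t| < 1 →
      ∫ x, (rieszTerm α φ x - rieszTerm α (sph P Q) x) *
          (1 - t * sph p q x) ^ (-((4 - α) / 2)) =
        2 * (4 - α) * (1 - t ^ 2) ^ (-((2 - α) / 2)) *
          ∫ x, ((φ x - sph P Q x) * wt x ^ 2) * (1 - t * sph p q x) ^ (-(α / 2)) := by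
    intro p q h t ht
    have hs : 0 < (4 - α) / 2 := by linarith
    simp only [sub_mul]
    rw [integral_sub (integrable_mul_rpow_sph hA h ht hs) (integrable_mul_rpow_sph hAv h ht hs),
      integral_sub (integrable_mul_rpow_sph hφi h ht (half_pos hα₀))
        (integrable_mul_rpow_sph hvi h ht (half_pos hα₀)),
      integral_rieszTerm_mul_rpow hα hφi h ht, integral_rieszTerm_mul_rpow hα hvi h ht]
    ring
  have hmom : ∀ (p : Plane) (q : ℝ) (k : ℕ),
      ∫ x, (φ x - sph P Q x) * wt x ^ 2 * sph p q x ^ k = 0 := by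
    intro p q k
    obtain ⟨c, p', q', h, e⟩ := exists_unit_sph p q
    have h0 := moments_eq_zero hα₀ hα hφ' (hA.sub hAv) (hsol.sub_sph hα hφ P Q) hgen
      (fun p q _ => horth p q) h k
    have e' : (fun x => (φ x - sph P Q x) * wt x ^ 2 * sph p q x ^ k) = fun x =>
        c ^ k * ((φ x - sph P Q x) * wt x ^ 2 * sph p' q' x ^ k) := by
      ext x; rw [e, mul_pow]; ring
    rw [e', integral_const_mul, h0, mul_zero]
  refine ⟨P, Q, ?_⟩
  filter_upwards [ae_eq_zero_of_moments hφ'.integrable_mul_wt_sq hmom] with x hx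
  have hw := (wt_pos x).ne'
  rcases mul_eq_zero.1 hx with h | h
  · linarith
  · exact absurd h (pow_ne_zero 2 hw)

/-! ### Weak gradient and weighted Sobolev norm -/

/-- The gradient of a linear function on the sphere. -/
def gradSph (p : Plane) (q : ℝ) (x : Plane) : Plane := WithLp.toLp 2 fun j => pd j (sph p q) x

lemma continuous_gradSph (p : Plane) (q : ℝ) : Continuous (gradSph p q) :=
  (PiLp.continuous_toLp 2 _).comp (continuous_pi fun j =>
    ((contDiff_sph (n := 1) p q).pd (m := 0) (by norm_num) j).continuous)

lemma norm_gradSph_sq (p : Plane) (q : ℝ) (x : Plane) :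
    ‖gradSph p q x‖ ^ 2 = 4 * wt x ^ 2 * (‖p‖ ^ 2 + q ^ 2 - sph p q x ^ 2) := by
  rw [← sum_pd_sph_sq, normSq_eq, Fin.sum_univ_two]
  rfl

lemma integral_norm_gradSph_sq (p : Plane) (q : ℝ) :
    Integrable (fun x => ‖gradSph p q x‖ ^ 2) ∧
      ∫ x, ‖gradSph p q x‖ ^ 2 = 8 * Real.pi / 3 * (‖p‖ ^ 2 + q ^ 2) := by
  obtain ⟨i2, e2⟩ := integral_wt_pow 2 (by norm_num)
  have i3 := integrable_wt_sq_mul_sph_mul_sph p p q q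
  have e : (fun x => ‖gradSph p q x‖ ^ 2) = fun x => 4 * (‖p‖ ^ 2 + q ^ 2) * wt x ^ 2 +
      -4 * (wt x ^ 2 * (sph p q x * sph p q x)) := by
    ext x; rw [norm_gradSph_sq]; ring
  rw [e]
  refine ⟨(i2.const_mul _).add (i3.const_mul _), ?_⟩
  rw [integral_add (i2.const_mul _) (i3.const_mul _), integral_const_mul, integral_const_mul, e2,
    integral_wt_sq_mul_sph_mul_sph, real_inner_self_eq_norm_sq]
  push_cast
  ring

lemma toReal_eLpNorm_two_sq {F : Type*} [NormedAddCommGroup F] {f : Plane → F}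
    (hf : MemLp f 2 volume) : (eLpNorm f 2 volume).toReal ^ 2 = ∫ x, ‖f x‖ ^ 2 := by
  have h0 : 0 ≤ ∫ x, ‖f x‖ ^ 2 := integral_nonneg fun x => sq_nonneg _
  rw [hf.eLpNorm_eq_integral_rpow_norm (by norm_num) (by norm_num)]
  simp only [ENNReal.toReal_ofNat, Real.rpow_two]
  rw [ENNReal.toReal_ofReal (by positivity), ← Real.rpow_natCast, ← Real.rpow_mul h0]
  norm_num

lemma hasWeakGradient_of_ae_eq_sph {φ : Plane → ℝ} {p : Plane} {q : ℝ}
    (h : φ =ᵐ[volume] sph p q) : HasWeakGradient φ (gradSph p q) := by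
  refine ⟨(continuous_sph p q).locallyIntegrable.congr h.symm,
    (continuous_gradSph p q).locallyIntegrable, fun ψ hψ j => ?_⟩
  have hψ1 : ContDiff ℝ 1 ψ := hψ.1.of_le ENat.LEInfty.out
  rw [show ∫ x, gradSph p q x j * ψ x = ∫ x, pd j (sph p q) x * ψ x from rfl,
    ← integral_mul_pd (contDiff_sph p q) hψ1 hψ.2]
  refine integral_congr_ae ?_
  filter_upwards [h] with x hx
  rw [hx, (hψ1.differentiable (by norm_num) x).lineDeriv_eq_fderiv, pd]

/-- The Dirichlet energy is $8$ times the squared weighted norm, as for any eigenfunction with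
eigenvalue $8$; adding the norm itself gives $9$. -/
lemma memH1w_and_norm_of_ae_eq_sph {φ : Plane → ℝ} (hφ : MemL2w φ) {p : Plane} {q : ℝ}
    (h : φ =ᵐ[volume] sph p q) : MemH1w φ ∧ h1wNorm φ = √(9 * l2wNorm φ ^ 2) := by
  have hG := hasWeakGradient_of_ae_eq_sph h
  have hW : HasWeakGradient φ (weakGradient φ) := by
    have hex : ∃ G, HasWeakGradient φ G := ⟨_, hG⟩
    rw [weakGradient, dif_pos hex]
    exact hex.choose_spec
  have hae := hW.ae_eq hG
  obtain ⟨gi, gv⟩ := integral_norm_gradSph_sq p q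
  have hGL : MemLp (gradSph p q) 2 volume :=
    (memLp_two_iff_integrable_sq_norm (continuous_gradSph p q).aestronglyMeasurable).2 gi
  refine ⟨⟨hW, (memLp_congr_ae hae).2 hGL, hφ⟩, ?_⟩
  have hl : l2wNorm φ ^ 2 = Real.pi / 3 * (‖p‖ ^ 2 + q ^ 2) := by
    rw [l2wNorm, toReal_eLpNorm_two_sq hφ, sq q, ← real_inner_self_eq_norm_sq,
      ← integral_wt_sq_mul_sph_mul_sph]
    refine integral_congr_ae ?_
    filter_upwards [h] with x hx
    rw [hx, Real.norm_eq_abs, sq_abs, div_eq_mul_inv, ← wt]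
    ring
  rw [h1wNorm, eLpNorm_congr_ae hae, toReal_eLpNorm_two_sq hGL, gv, hl]
  congr 1
  ring

/-! ### Derivatives of the bubble family in its parameters -/

lemma lineDeriv_bubbleFamily {α : ℝ} (hα : α < 2) (x : Plane) (j : Fin 2) :
    lineDeriv ℝ (fun ζ => bubbleFamily α 1 ζ x) 0 (stdVec j) =
      (4 - α) * x j / (1 + ‖x‖ ^ 2) := by
  have hC := bubbleConst_pos hα
  have hx := one_add_normSq_pos x
  have hn : ∀ t : ℝ, 1 + 1 ^ 2 * ‖x - (0 + t • stdVec j)‖ ^ 2 =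
      1 + ‖x‖ ^ 2 - 2 * t * x j + t ^ 2 := by
    intro t
    rw [zero_add, norm_sub_sq_real, inner_smul_right, inner_stdVec, norm_smul]
    simp [stdVec]
    ring
  have h1 : HasDerivAt (fun t : ℝ => 1 + ‖x‖ ^ 2 - 2 * t * x j + t ^ 2) (-2 * x j) 0 := by
    have := ((((hasDerivAt_id (0 : ℝ)).const_mul 2).mul_const (x j)).const_sub
      (1 + ‖x‖ ^ 2)).fun_add (hasDerivAt_pow 2 (0 : ℝ))
    simpa using this
  have h2 : HasDerivAt (fun t : ℝ => (4 - α) / 2 * Real.log (bubbleConst α * 1 /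
      (1 + ‖x‖ ^ 2 - 2 * t * x j + t ^ 2))) ((4 - α) * x j / (1 + ‖x‖ ^ 2)) 0 := by
    have h3 := ((((hasDerivAt_const (0 : ℝ) (bubbleConst α * 1)).div h1
      (by simpa using hx.ne')).log (by simp [hC.ne', hx.ne'])).const_mul ((4 - α) / 2))
    refine h3.congr_deriv ?_
    simp
    field_simp
  have h4 : HasLineDerivAt ℝ (fun ζ => bubbleFamily α 1 ζ x) ((4 - α) * x j / (1 + ‖x‖ ^ 2)) 0
      (stdVec j) := by
    unfold HasLineDerivAt bubbleFamily
    simpa only [hn] using h2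
  exact h4.lineDeriv

lemma deriv_bubbleFamily {α : ℝ} (hα : α < 2) (x : Plane) :
    deriv (fun μ => bubbleFamily α μ 0 x) 1 =
      (4 - α) / 2 * ((1 - ‖x‖ ^ 2) / (1 + ‖x‖ ^ 2)) := by
  have hC := bubbleConst_pos hα
  have hx := one_add_normSq_pos x
  have h1 : HasDerivAt (fun μ : ℝ => 1 + μ ^ 2 * ‖x - 0‖ ^ 2) (2 * ‖x‖ ^ 2) 1 := by
    have := ((hasDerivAt_pow 2 (1 : ℝ)).mul_const (‖x - 0‖ ^ 2)).const_add 1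
    simpa using this
  have h2 : HasDerivAt (fun μ : ℝ => bubbleConst α * μ) (bubbleConst α) 1 := by
    simpa using (hasDerivAt_id (1 : ℝ)).const_mul (bubbleConst α)
  have h3 := ((h2.div h1 (by simpa using hx.ne')).log
    (by simp [hC.ne', hx.ne'])).const_mul ((4 - α) / 2)
  have h4 : HasDerivAt (fun μ => bubbleFamily α μ 0 x)
      ((4 - α) / 2 * ((1 - ‖x‖ ^ 2) / (1 + ‖x‖ ^ 2))) 1 := by
    refine h3.congr_deriv ?_
    simp only [Pi.div_apply, sub_zero, one_pow, one_mul, mul_one]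
    field_simp
    ring
  exact h4.deriv

end

/-! ### The main theorem -/

theorem theorem1p1 (α : ℝ) (hα₀ : 0 < α) (hα₂ : α < 2) (φ : Plane → ℝ) (hφ : MemL2w φ)
    (hsol : IsDistributionalSolution φ (linearizedRHS α φ)) :
    -- both sides of the equation are locally integrable, so that the hypothesis is meaningful
    LocallyIntegrable φ volume ∧ LocallyIntegrable (linearizedRHS α φ) volume ∧
    -- `φ` is bounded, and (up to a null set) a smooth function `v`
    MemLp φ ⊤ volume ∧
    (∃ v : Plane → ℝ, φ =ᵐ[volume] v ∧ ContDiff ℝ ∞ v ∧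
      -- the integral identity
      Integrable (Δ v) volume ∧
      Integrable (fun x => Real.exp (4 / (4 - α) * bubble α x) * φ x) volume ∧
      -∫ x, (Δ v) x = 4 * (4 - α) / bubbleConst α ^ 2 *
        ∫ x, Real.exp (4 / (4 - α) * bubble α x) * φ x ∧
      4 * (4 - α) / bubbleConst α ^ 2 *
        ∫ x, Real.exp (4 / (4 - α) * bubble α x) * φ x = 0 ∧
      -- the representation
      ∃ (a : Fin 2 → ℝ) (b : ℝ), ∀ x : Plane,
        v x = (∑ j, a j * lineDeriv ℝ (fun ζ => bubbleFamily α 1 ζ x) 0 (stdVec j)) +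
            b * deriv (fun μ => bubbleFamily α μ 0 x) 1 ∧
        v x = (∑ j, a j * ((4 - α) * x j / (1 + ‖x‖ ^ 2))) +
            b * ((4 - α) / 2 * ((1 - ‖x‖ ^ 2) / (1 + ‖x‖ ^ 2)))) ∧
    -- the weighted Sobolev estimate
    MemH1w φ ∧ h1wNorm φ ≤ √(4 * (4 - α) + 1) * l2wNorm φ := by
  obtain ⟨p, q, hae⟩ := exists_ae_eq_sph hα₀ hα₂ hφ hsol
  have h4 : 4 - α ≠ 0 := by linarith
  obtain ⟨hH, hN⟩ := memH1w_and_norm_of_ae_eq_sph hφ hae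
  have hint : ∫ x, Real.exp (4 / (4 - α) * bubble α x) * φ x = 0 := by
    have e : (fun x => Real.exp (4 / (4 - α) * bubble α x) * φ x) =ᵐ[volume]
        fun x => bubbleConst α ^ 2 * (wt x ^ 2 * sph p q x) := by
      filter_upwards [hae] with x hx
      rw [hx, exp_four_div_bubble hα₂]; ring
    rw [integral_congr_ae e, integral_const_mul, integral_wt_sq_mul_sph, mul_zero]
  have hΔ : Δ (sph p q) = fun x => -8 * (wt x ^ 2 * sph p q x) := by
    ext x; rw [laplacian_sph]; ring
  have hrep : ∀ x : Plane, sph p q x = (∑ j, 2 * p j / (4 - α) *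
      ((4 - α) * x j / (1 + ‖x‖ ^ 2))) +
        2 * q / (4 - α) * ((4 - α) / 2 * ((1 - ‖x‖ ^ 2) / (1 + ‖x‖ ^ 2))) := by
    intro x
    have hx := (one_add_normSq_pos x).ne'
    rw [sph, wt, inner_eq, Fin.sum_univ_two]
    field_simp
  refine ⟨hφ.locallyIntegrable, (integrable_linearizedRHS hα₂ hφ).locallyIntegrable, ?_,
    ⟨sph p q, hae, contDiff_sph p q, ?_, ?_, ?_, ?_, fun j => 2 * p j / (4 - α),
      2 * q / (4 - α), fun x => ⟨?_, hrep x⟩⟩, hH, ?_⟩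
  · refine memLp_top_of_bound hφ.aestronglyMeasurable (√(‖p‖ ^ 2 + q ^ 2)) ?_
    filter_upwards [hae] with x hx
    rw [hx]
    exact abs_sph_le p q x
  · rw [hΔ]
    exact (integrable_wt_sq_mul_sph p q).const_mul _
  · refine (hφ.integrable_mul_wt_sq.const_mul (bubbleConst α ^ 2)).congr
      (Filter.Eventually.of_forall fun x => ?_)
    simp only [exp_four_div_bubble hα₂]
    ring
  · rw [hint, hΔ, integral_const_mul, integral_wt_sq_mul_sph]
    simp
  · rw [hint, mul_zero]
  · simp only [lineDeriv_bubbleFamily hα₂, deriv_bubbleFamily hα₂]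
    exact hrep x
  -- The exact constant is $\sqrt9$, and $9\le4(4-\alpha)+1$ because $\alpha<2$.
  · have hl : 0 ≤ l2wNorm φ := ENNReal.toReal_nonneg
    rw [hN, Real.sqrt_mul (by norm_num), Real.sqrt_sq hl]
    gcongr
    linarith
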